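/- Consider the two-user broadcast packet erasure channel with feedback. Time is slotted. At the beginning of every slot $t$ a new packet is generated for each of the users $1,2$; the contents of the packets are independent and uniformly distributed on a finite set $\mathcal A$ with at least two elements. In each slot $k=1,2,\dots$ the encoder sends one element $X(k)\in\mathcal A$; user $i$ receives $Y_i(k)=X(k)$ if $Z_i(k)=1$ and an erasure symbol if $Z_i(k)=0$. The pairs $(Z_1(k),Z_2(k))$, $k\ge 1$, are independent of the packets and i.i.d. over $k$, with $\epsilon_i=\Pr(Z_i(k)=0)<1$ and $\epsilon_{12}=\Pr(Z_1(k)=Z_2(k)=0)$ (the components may be correlated). A communication policy $\pi$ (coded or not, possibly randomized, its randomization being independent of packets and channel) chooses $X(k)$ as an arbitrary function of its randomization, of the packets generated up to slot $k$ (among those generated before slot $1$, finitely many are available), and of the feedback $(Z_1(j),Z_2(j))_{j<k}$. Both users are informed of the feedback and of the randomization, and initially user $i$ may know an arbitrary function of the available packets generated before slot $1$. A packet intended for user $i$ has been received by user $i$ at the beginning of slot $k$ if its content is determined by what user $i$ knows at that time. The age $h_i^\pi(k)$ is $k$ minus the generation slot of the freshest packet of user $i$ that it has received by the beginning of slot $k$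 (at the beginning of slot $1$ user $i$ is given a packet of an arbitrary fixed finite age $\geq 1$, which is used if no fresher packet has been received). Let $\alpha_1,\alpha_2\ge 0$ with $\alpha_1+\alpha_2=1$, and $$J_T^\pi=\frac1{2T}\sum_{k=1}^T\sum_{i=1}^2\alpha_i h_i^\pi(k),\qquad B=\frac14\left(\frac{\left(\sum_{i=1}^2\sqrt{\alpha_i(2-\epsilon_{12}-\epsilon_{\backslash i})}\right)^2}{(1-\epsilon_{12})(2-\epsilon_1-\epsilon_2)}+1\right),$$ where $\backslash i$ denotes the user other than $i$. Then for every communication policy $\pi$ $$\liminf_{T\to\infty}\mathbb E[J_T^\pi]\ \ge\ B,$$ and, whenever the limit $J^\pi=\lim_{T\to\infty}J_T^\pi\in[0,\infty]$ exists almost surely, $\mathbb E[J^\pi]\ge B$. -/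

import Mathlib

open MeasureTheory ProbabilityTheory Filter Topology
open scoped ENNReal

/-- The contents of all packets: `w i t` is the content of the packet intended for user `i` and
generated at the beginning of slot `t`. Transmission takes place in the slots `1, 2, 3, …`; the
packets with `t ≤ 0` were generated before. Packet contents are elements of a finite set `A`. -/
abbrev Packets (A : Type*) := Fin 2 → ℤ → A

/-- The erasure pattern: `z k i = true` if in slot `k` the channel input reaches user `i`, and
`z k i = false` if it is erased at user `i`. -/
abbrev Pattern := ℕ → Fin 2 → Bool

/-- The user different from `i`. -/
def otherUser (i : Fin 2) : Fin 2 := 1 - i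

/-- The state of the system at the beginning of slot `1`. -/
structure InitialState (A : Type*) where
  /-- `age i` is the age at user `i` at the beginning of slot `1`. -/
  age : Fin 2 → ℕ
  age_pos : ∀ i, 1 ≤ age i
  /-- Only the packets of the last `past` slots before slot `1` are still around. -/
  past : ℕ
  /-- What user `i` knows (in an arbitrary encoding) about these old packets, for instance old
  packets of the other user that it has overheard. -/
  side : Fin 2 → Packets A → ℕ
  side_old : ∀ (i : Fin 2) (w w' : Packets A),
    (∀ (j : Fin 2) (t : ℤ), -(past : ℤ) < t → t ≤ 0 → w j t = w' j t) → side i w = side i w'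

/-- A communication policy, given by the encoder. In every slot `k` the channel input is an
arbitrary function of the randomization `θ` of the policy, of the packets generated up to slot `k`,
and of the feedback, i.e. of the erasure pattern of the slots before `k`. -/
structure Policy (A Θ : Type*) [MeasurableSpace A] [MeasurableSpace Θ] (S : InitialState A) where
  input : ℕ → Θ → Packets A → Pattern → A
  causal : ∀ (k : ℕ) (θ : Θ) (w w' : Packets A) (z z' : Pattern),
    (∀ (i : Fin 2) (t : ℤ), -(S.past : ℤ) < t → t ≤ (k : ℤ) → w i t = w' i t) →
    (∀ j : ℕ, 1 ≤ j → j < k → z j = z' j) →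
    input k θ w z = input k θ w' z'
  measurable_input : ∀ (k : ℕ) (w : Packets A) (z : Pattern), Measurable fun θ => input k θ w z

namespace Policy

variable {A Θ : Type*} [MeasurableSpace A] [MeasurableSpace Θ] {S : InitialState A}

/-- The channel output at user `i` in slot `k`; `none` is the erasure symbol. -/
def output (π : Policy A Θ S) (i : Fin 2) (k : ℕ) (θ : Θ) (w : Packets A) (z : Pattern) :
    Option A :=
  if z k i = true then some (π.input k θ w z) else none

/-- At the beginning of slot `k` user `i` has received its packet of slot `t`: the content of this
packet is determined by all that user `i` knows, namely its initial knowledge and its channel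
outputs in the slots before `k`, together with the erasure pattern and the randomization of the
policy (of which both users are informed). -/
def Received (π : Policy A Θ S) (i : Fin 2) (k : ℕ) (θ : Θ) (w : Packets A) (z : Pattern)
    (t : ℤ) : Prop :=
  ∀ w' : Packets A, S.side i w' = S.side i w →
    (∀ j : ℕ, 1 ≤ j → j < k → π.output i j θ w' z = π.output i j θ w z) → w' i t = w i t

/-- The age of information `h_i(k)` at user `i` at the beginning of slot `k ≥ 1`: the time since the
generation of the freshest packet received, where the packet that is the freshest one at the
beginning of slot `1` has age `S.age i + k - 1`. -/
noncomputable def age (π : Policy A Θ S) (i : Fin 2) (k : ℕ) (θ : Θ) (w : Packets A)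
    (z : Pattern) : ℕ :=
  sInf {a : ℕ | a + 1 = S.age i + k ∨
    ∃ t : ℤ, t < (k : ℤ) ∧ π.Received i k θ w z t ∧ (a : ℤ) = (k : ℤ) - t}

/-- The weighted sum age `J_T = (1 / (2T)) ∑_{k=1}^T ∑_i α_i h_i(k)` up to slot `T`. -/
noncomputable def weightedAge (π : Policy A Θ S) (α : Fin 2 → ℝ) (T : ℕ) (θ : Θ) (w : Packets A)
    (z : Pattern) : ℝ :=
  1 / (2 * (T : ℝ)) * ∑ k ∈ Finset.Icc 1 T, ∑ i : Fin 2, α i * (π.age i k θ w z : ℝ)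

end Policy

/-- The random experiment. The packet contents `W i t` are independent and uniformly distributed on
`A`. The channel is memoryless: the pairs `(Z k 0, Z k 1)` of erasure variables are independent over
the slots `k`, user `i` suffers an erasure with probability `ε i`, and both users simultaneously with
probability `ε₁₂`. The packets, the channel and the randomization `θ` of the policy are
independent. -/
structure IsErasureModel {Ω A Θ : Type*} [MeasurableSpace Ω] [Fintype A] [MeasurableSpace A]
    [MeasurableSpace Θ] (P : Measure Ω) (ε : Fin 2 → ℝ) (ε₁₂ : ℝ)
    (W : Fin 2 → ℤ → Ω → A) (Z : ℕ → Fin 2 → Ω → Bool) (θ : Ω → Θ) : Prop where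
  measurable_packet : ∀ i t, Measurable (W i t)
  measurable_channel : ∀ k i, Measurable (Z k i)
  measurable_random : Measurable θ
  uniform_packet : ∀ i t a, P.real {ω | W i t ω = a} = 1 / (Fintype.card A : ℝ)
  indep_packet : iIndepFun (fun (p : Fin 2 × ℤ) (ω : Ω) => W p.1 p.2 ω) P
  erasure : ∀ k i, P.real {ω | Z k i ω = false} = ε i
  erasure_both : ∀ k, P.real {ω | Z k 0 ω = false ∧ Z k 1 ω = false} = ε₁₂
  indep_channel : iIndepFun (fun (k : ℕ) (ω : Ω) (i : Fin 2) => Z k i ω) P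
  indep_packet_rest : IndepFun (fun (ω : Ω) (p : Fin 2 × ℤ) => W p.1 p.2 ω)
    (fun ω : Ω => (θ ω, fun (k : ℕ) (i : Fin 2) => Z k i ω)) P
  indep_random_channel : IndepFun θ (fun (ω : Ω) (k : ℕ) (i : Fin 2) => Z k i ω) P

/-- The lower bound on the expected weighted sum age. -/
noncomputable def ageLowerBound (α ε : Fin 2 → ℝ) (ε₁₂ : ℝ) : ℝ :=
  1 / 4 * ((∑ i : Fin 2, √(α i * (2 - ε₁₂ - ε (otherUser i)))) ^ 2 /
    ((1 - ε₁₂) * (2 - ε 0 - ε 1)) + 1)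

/-! The bound combines an outer bound on how many packets the users can decode with a convexity
estimate of the age.

Outer bound. With the randomization and the erasure pattern frozen, inputs and outputs are functions
of finitely many uniform packets, so entropies reduce to counting fibres. All packets generated
before slot 1 are revealed to both users. The packets that user `i` decodes cost at most the
information its outputs carry about them; in each slot reaching `i` this is at most log |A| minus
the entropy `βw` of the input given user `i`'s own packets and past outputs. The other user `j` is
strengthened: it sees the outputs of both users and knows the packets of `i`. Its packets cost at
most the corresponding input entropy `βs` in each slot reaching somebody, and `βs ≤ βw` because
conditioning reduces entropy. Both entropies are settled before the slot, hence independent of its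
erasures, so expectations produce the factors 1 - ε_i and 1 - ε₁₂
(`weighted_integral_card_decoded_le`). Adding the bounds for the two orders of the users gives Σ c_i
E[m_i] ≤ T C, where m_i counts decoded packets, c_i = 2 - ε₁₂ - ε_{other}, C = (1 - ε₁₂)(2 - ε₁ -
ε₂).

Age. If m packets are decoded within the horizon, the ages add up to about T²/(2m) + T/2 or more.
Only tangents of this convex function of m are needed: for every real l the sum is at least (l +
1/2) T - l²/2 (1 + m) (`Policy.sum_age_ge`). This holds pathwise and is affine in m, so expectations
can be taken directly. The optimal slopes l_i turn the weighted sum into a multiple of Σ c_i m_i.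

The resulting lower bound `Q` for J is measurable and bounded above, so reverse Fatou also covers
the almost sure limit, without any measurability of J. -/

/-! ### Entropy inequalities by counting fibres -/

section Entropy

variable {V α β γ : Type*} [Fintype V]

open Classical in
/-- The number of points at which `f` takes the same value as at `v`. -/
noncomputable def fiberCard (f : V → α) (v : V) : ℕ :=
  (Finset.univ.filter fun u => f u = f v).card

/-- The sum of the logarithms of the fibre sizes of `f`: up to the factor `card V` this is the
conditional entropy of a uniformly distributed `v : V` given `f v`. -/
noncomputable def fiberEntropy (f : V → α) : ℝ :=
  ∑ v, Real.log (fiberCard f v)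

theorem fiberCard_pos (f : V → α) (v : V) : 0 < fiberCard f v := by
  classical
  exact Finset.card_pos.2 ⟨v, by simp⟩

theorem fiberCard_congr_fun {f : V → α} {g : V → β} {v : V}
    (h : ∀ u, f u = f v ↔ g u = g v) : fiberCard f v = fiberCard g v := by
  classical
  unfold fiberCard
  simp only [h]

theorem fiberCard_congr {f : V → α} {u v : V} (h : f u = f v) : fiberCard f u = fiberCard f v := by
  unfold fiberCard
  rw [h]

theorem fiberEntropy_congr {f : V → α} {g : V → β} (h : ∀ u v, f u = f v ↔ g u = g v) :
    fiberEntropy f = fiberEntropy g :=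
  Finset.sum_congr rfl fun v _ => by rw [fiberCard_congr_fun fun u => h u v]

theorem fiberEntropy_of_injective {f : V → α} (h : Function.Injective f) : fiberEntropy f = 0 := by
  classical
  refine Finset.sum_eq_zero fun v _ => ?_
  have : fiberCard f v = 1 := by
    unfold fiberCard
    rw [Finset.card_eq_one]
    exact ⟨v, by ext u; simp [h.eq_iff]⟩
  simp [this]

open Classical in
-- The points of `s` lie in one fibre, so the terms are reciprocals of one number that is at least
-- `s.card`.
theorem sum_inv_fiberCard_le_one (f : V → α) (c : α) (s : Finset V) (hs : ∀ v ∈ s, f v = c) :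
    ∑ v ∈ s, (1 : ℝ) / fiberCard f v ≤ 1 := by
  have hsub : s ⊆ Finset.univ.filter fun u => f u = c := fun v hv => by simp [hs v hv]
  have hcard : ∀ v ∈ s, (1 : ℝ) / fiberCard f v
      = 1 / ((Finset.univ.filter fun u => f u = c).card : ℝ) := by
    intro v hv
    unfold fiberCard
    rw [hs v hv]
  rw [Finset.sum_congr rfl hcard, Finset.sum_const, nsmul_eq_mul, mul_one_div]
  exact div_le_one_of_le₀ (by exact_mod_cast Finset.card_le_card hsub) (by positivity)

open Classical in
theorem fiberCard_eq_sum (f : V → α) (v : V) :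
    (fiberCard f v : ℝ) = ∑ u, if f u = f v then (1 : ℝ) else 0 := by
  unfold fiberCard
  simp

/-- Jensen's inequality via log x ≤ x - 1. It reduces both entropy inequalities below to double
counting. -/
theorem sum_log_nonpos_of_sum_le {r : V → ℝ} (hr : ∀ v, 0 < r v)
    (h : ∑ v, r v ≤ Fintype.card V) : ∑ v, Real.log (r v) ≤ 0 := by
  calc ∑ v, Real.log (r v) ≤ ∑ v, (r v - 1) :=
        Finset.sum_le_sum fun v _ => Real.log_le_sub_one_of_pos (hr v)
    _ ≤ 0 := by
      rw [Finset.sum_sub_distrib]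
      simpa using h

open Classical in
/-- A conditional entropy is at most the expected logarithm of the number of possible values. -/
theorem fiberEntropy_sub_le_sum_log (f : V → α) (g : V → β) :
    fiberEntropy f - fiberEntropy (fun v => (f v, g v)) ≤
      ∑ v, Real.log (((Finset.univ.filter fun u => f u = f v).image g).card) := by
  set m : V → ℕ := fun v => ((Finset.univ.filter fun u => f u = f v).image g).card with hm
  have hmpos : ∀ v, 0 < m v := fun v =>
    Finset.card_pos.2 ⟨g v, Finset.mem_image_of_mem g (by simp)⟩
  have key : ∑ v, Real.log ((fiberCard f v : ℝ) / (fiberCard (fun v => (f v, g v)) v * m v)) ≤ 0 := by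
    refine sum_log_nonpos_of_sum_le (fun v => ?_) ?_
    · have := fiberCard_pos f v
      have := fiberCard_pos (fun v => (f v, g v)) v
      have := hmpos v
      positivity
    have h1 : ∀ v, (fiberCard f v : ℝ) / (fiberCard (fun v => (f v, g v)) v * m v)
        = ∑ u, if f v = f u then 1 / (fiberCard (fun v => (f v, g v)) v : ℝ) / m u else 0 := by
      intro v
      rw [fiberCard_eq_sum, Finset.sum_div]
      refine Finset.sum_congr rfl fun u _ => ?_
      by_cases h : f u = f v
      · have : m u = m v := by simp only [hm, h]
        simp [h, this, div_eq_mul_inv, mul_comm]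
      · simp [h, Ne.symm h]
    rw [Finset.sum_congr rfl fun v _ => h1 v, Finset.sum_comm]
    calc _ ≤ ∑ _u : V, (1 : ℝ) := ?_
      _ = _ := by simp
    -- For fixed `u`, the points `v` of its `f`-fibre are grouped by `g v`: there are `m u` groups,
    -- each contributing at most `1 / m u`.
    refine Finset.sum_le_sum fun u _ => ?_
    rw [← Finset.sum_filter, ← Finset.sum_div]
    refine div_le_one_of_le₀ ?_ (by positivity)
    rw [← Finset.sum_fiberwise_of_maps_to
      (t := (Finset.univ.filter fun v => f v = f u).image g) (g := g)
      (fun v hv => Finset.mem_image_of_mem g hv)]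
    calc _ ≤ ∑ _c ∈ (Finset.univ.filter fun v => f v = f u).image g, (1 : ℝ) := ?_
      _ = m u := by simp [hm]
    refine Finset.sum_le_sum fun c _ => ?_
    refine sum_inv_fiberCard_le_one (fun v => (f v, g v)) (f u, c) _ fun v hv => ?_
    simp only [Finset.mem_filter, Finset.mem_univ, true_and] at hv
    simp [hv]
  have h2 : ∀ v, Real.log ((fiberCard f v : ℝ) / (fiberCard (fun v => (f v, g v)) v * m v))
      = Real.log (fiberCard f v) - Real.log (fiberCard (fun v => (f v, g v)) v)
        - Real.log (m v) := by
    intro v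
    have h1 : (fiberCard f v : ℝ) ≠ 0 := by exact_mod_cast (fiberCard_pos f v).ne'
    have h2 : (fiberCard (fun v => (f v, g v)) v : ℝ) ≠ 0 := by
      exact_mod_cast (fiberCard_pos _ v).ne'
    have h3 : (m v : ℝ) ≠ 0 := by exact_mod_cast (hmpos v).ne'
    rw [Real.log_div h1 (mul_ne_zero h2 h3), Real.log_mul h2 h3]
    ring
  simp only [h2, Finset.sum_sub_distrib] at key
  unfold fiberEntropy
  linarith

theorem fiberEntropy_sub_le [Fintype β] (f : V → α) (g : V → β) :
    fiberEntropy f - fiberEntropy (fun v => (f v, g v)) ≤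
      Fintype.card V * Real.log (Fintype.card β) := by
  classical
  refine (fiberEntropy_sub_le_sum_log f g).trans ?_
  calc _ ≤ ∑ _v : V, Real.log (Fintype.card β) := ?_
    _ = _ := by simp
  refine Finset.sum_le_sum fun v _ => Real.log_le_log ?_ ?_
  · exact_mod_cast Finset.card_pos.2 ⟨g v, Finset.mem_image_of_mem g (by simp)⟩
  · exact_mod_cast Finset.card_le_univ _

/-- Conditioning reduces entropy. -/
theorem fiberEntropy_submodular (f : V → α) (g : V → β) (x : V → γ) :
    fiberEntropy (fun v => (f v, g v)) - fiberEntropy (fun v => ((f v, g v), x v)) ≤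
      fiberEntropy f - fiberEntropy (fun v => (f v, x v)) := by
  classical
  set n := fiberCard f with hn
  set ng := fiberCard (fun v => (f v, g v)) with hng
  set nx := fiberCard (fun v => (f v, x v)) with hnx
  set ngx := fiberCard (fun v => ((f v, g v), x v)) with hngx
  have key : ∑ v, Real.log ((nx v : ℝ) * ng v / (n v * ngx v)) ≤ 0 := by
    refine sum_log_nonpos_of_sum_le (fun v => ?_) ?_
    · have h1 : 0 < n v := fiberCard_pos _ v
      have h2 : 0 < ng v := fiberCard_pos _ v
      have h3 : 0 < nx v := fiberCard_pos _ v
      have h4 : 0 < ngx v := fiberCard_pos _ v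
      positivity
    -- The numerator counts pairs `(u, u')`. Once such a pair is fixed, the admissible `v` all lie
    -- in the single fibre with value `((f u, g u'), x u)`, so their weights `1 / ngx v` add up to
    -- at most one.
    have h1 : ∀ v, (nx v : ℝ) * ng v / (n v * ngx v)
        = ∑ u, ∑ u', if (f u = f v ∧ x u = x v) ∧ (f u' = f v ∧ g u' = g v) then
            1 / (ngx v : ℝ) / n u else 0 := by
      intro v
      rw [hnx, hng, fiberCard_eq_sum, fiberCard_eq_sum, Finset.sum_mul_sum, Finset.sum_div]
      refine Finset.sum_congr rfl fun u _ => ?_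
      rw [Finset.sum_div]
      refine Finset.sum_congr rfl fun u' _ => ?_
      by_cases h : f u = f v ∧ x u = x v
      · by_cases h' : f u' = f v ∧ g u' = g v
        · have : n u = n v := fiberCard_congr h.1
          simp [h, h', this, div_eq_mul_inv, mul_comm]
        · simp [h']
      · simp [h]
    rw [Finset.sum_congr rfl fun v _ => h1 v, Finset.sum_comm]
    calc _ ≤ ∑ u : V, ∑ u' : V, (if f u' = f u then (1 : ℝ) / n u else 0) := ?_
      _ = ∑ _u : V, (1 : ℝ) := ?_
      _ = _ := by simp
    · refine Finset.sum_le_sum fun u _ => ?_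
      rw [Finset.sum_comm]
      refine Finset.sum_le_sum fun u' _ => ?_
      rw [← Finset.sum_filter, ← Finset.sum_div]
      split_ifs with h
      · gcongr
        refine sum_inv_fiberCard_le_one (fun v => ((f v, g v), x v)) ((f u, g u'), x u) _
          fun v hv => ?_
        simp only [Finset.mem_filter, Finset.mem_univ, true_and] at hv
        simp [hv]
      · rw [Finset.filter_false_of_mem]
        · simp
        · rintro v - ⟨⟨h1, -⟩, h2, -⟩
          exact h (h2.trans h1.symm)
    · refine Finset.sum_congr rfl fun u _ => ?_
      have h1 : (n u : ℝ) ≠ 0 := by exact_mod_cast (fiberCard_pos f u).ne'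
      have h2 := fiberCard_eq_sum f u
      rw [← Finset.sum_filter, Finset.sum_const, nsmul_eq_mul, mul_one_div]
      exact div_self h1
  have h2 : ∀ v, Real.log ((nx v : ℝ) * ng v / (n v * ngx v))
      = Real.log (nx v) + Real.log (ng v) - Real.log (n v) - Real.log (ngx v) := by
    intro v
    have h1 : (n v : ℝ) ≠ 0 := by exact_mod_cast (fiberCard_pos _ v).ne'
    have h2 : (ng v : ℝ) ≠ 0 := by exact_mod_cast (fiberCard_pos _ v).ne'
    have h3 : (nx v : ℝ) ≠ 0 := by exact_mod_cast (fiberCard_pos _ v).ne'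
    have h4 : (ngx v : ℝ) ≠ 0 := by exact_mod_cast (fiberCard_pos _ v).ne'
    rw [Real.log_div (mul_ne_zero h3 h2) (mul_ne_zero h1 h4), Real.log_mul h3 h2,
      Real.log_mul h1 h4]
    ring
  simp only [h2, Finset.sum_sub_distrib, Finset.sum_add_distrib] at key
  unfold fiberEntropy
  linarith

end Entropy

/-! ### Uniform vectors and the coordinates determined by an observation -/

section CoordinateFibers

variable {I A : Type*} [Fintype I] [DecidableEq I] [Fintype A]

open Classical in
theorem card_filter_eq_on (s : Finset I) (v : I → A) :
    (Finset.univ.filter fun u : I → A => ∀ i ∈ s, u i = v i).card =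
      Fintype.card A ^ (Fintype.card I - s.card) := by
  have : (Finset.univ.filter fun u : I → A => ∀ i ∈ s, u i = v i)
      = Fintype.piFinset fun i => if i ∈ s then {v i} else Finset.univ := by
    ext u
    simp only [Finset.mem_filter, Finset.mem_univ, true_and, Fintype.mem_piFinset]
    refine forall_congr' fun i => ?_
    by_cases h : i ∈ s <;> simp [h]
  rw [this, Fintype.card_piFinset]
  have : ∀ i, (if i ∈ s then ({v i} : Finset A) else Finset.univ).card
      = if i ∈ s then 1 else Fintype.card A := by
    intro i
    split_ifs <;> simp
  rw [Finset.prod_congr rfl fun i _ => this i, Finset.prod_ite]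
  simp only [Finset.prod_const, one_pow, one_mul]
  congr 1
  rw [← Finset.compl_filter, Finset.card_compl]
  simp

/-- The uncertainty about a uniformly distributed vector some coordinates of which are known. -/
theorem fiberEntropy_restrict (s : Finset I) :
    fiberEntropy (fun v : I → A => s.restrict v) =
      Fintype.card (I → A) * ((Fintype.card I - s.card : ℝ) * Real.log (Fintype.card A)) := by
  classical
  have hle : s.card ≤ Fintype.card I := Finset.card_le_univ s
  have : ∀ v : I → A, Real.log (fiberCard (fun v : I → A => s.restrict v) v)
      = (Fintype.card I - s.card : ℝ) * Real.log (Fintype.card A) := by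
    intro v
    have h : fiberCard (fun v : I → A => s.restrict v) v
        = Fintype.card A ^ (Fintype.card I - s.card) := by
      rw [← card_filter_eq_on s v]
      unfold fiberCard
      simp only [funext_iff, Finset.restrict, Subtype.forall]
    rw [h, Nat.cast_pow, Real.log_pow, Nat.cast_sub hle]
  unfold fiberEntropy
  rw [Finset.sum_congr rfl fun v _ => this v]
  simp only [Finset.sum_const, nsmul_eq_mul, Finset.card_univ]

open Classical in
/-- The coordinates in `s` whose value at `v` is determined by the value of `f`. -/
noncomputable def determinedCoords {α : Type*} (f : (I → A) → α) (s : Finset I) (v : I → A) :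
    Finset I :=
  s.filter fun i => ∀ u, f u = f v → u i = v i

theorem mem_determinedCoords {α : Type*} {f : (I → A) → α} {s : Finset I} {v : I → A} {i : I} :
    i ∈ determinedCoords f s v ↔ i ∈ s ∧ ∀ u, f u = f v → u i = v i := by
  classical
  simp only [determinedCoords, Finset.mem_filter]

theorem determinedCoords_subset {α : Type*} (f : (I → A) → α) (s : Finset I) (v : I → A) :
    determinedCoords f s v ⊆ s := fun _ hi => (mem_determinedCoords.1 hi).1

open Classical in
-- Determined coordinates are constant on the fibre; only the remaining ones can vary.
theorem card_image_restrict_fiber_le {α : Type*} (f : (I → A) → α) (s : Finset I) (v : I → A) :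
    ((Finset.univ.filter fun u => f u = f v).image fun u : I → A => s.restrict u).card ≤
      Fintype.card A ^ (s.card - (determinedCoords f s v).card) := by
  have hd := determinedCoords_subset f s v
  have hdc : ((determinedCoords f s v).subtype (· ∈ s)).card = (determinedCoords f s v).card := by
    rw [Finset.card_subtype, Finset.filter_true_of_mem fun i hi => hd hi]
  have hc := card_filter_eq_on (A := A) ((determinedCoords f s v).subtype (· ∈ s)) (s.restrict v)
  rw [hdc, Fintype.card_coe] at hc
  rw [← hc]
  refine Finset.card_le_card fun w hw => ?_
  obtain ⟨u, hu, rfl⟩ := Finset.mem_image.1 hw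
  refine Finset.mem_filter.2 ⟨Finset.mem_univ _, fun i hi => ?_⟩
  exact (mem_determinedCoords.1 (Finset.mem_subtype.1 hi)).2 u (Finset.mem_filter.1 hu).2

/-- A zero-error Fano inequality: up to the factor `card (I → A)`, the right side is the mutual
information of `f` and the coordinates `s`. Which coordinates are determined may depend on `v`, so
only the sum over `v` is bounded. -/
theorem sum_card_determinedCoords_le {α : Type*} (f : (I → A) → α) (s : Finset I) :
    (∑ v, ((determinedCoords f s v).card : ℝ)) * Real.log (Fintype.card A) ≤
      Fintype.card (I → A) * (s.card * Real.log (Fintype.card A)) -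
        (fiberEntropy f - fiberEntropy (fun v => (f v, s.restrict v))) := by
  classical
  have h := fiberEntropy_sub_le_sum_log f (fun v : I → A => s.restrict v)
  have h2 : ∀ v : I → A,
      Real.log (((Finset.univ.filter fun u => f u = f v).image
        (fun v : I → A => s.restrict v)).card) ≤
      (s.card - (determinedCoords f s v).card) * Real.log (Fintype.card A) := by
    intro v
    have hpos : 0 < ((Finset.univ.filter fun u => f u = f v).image
        (fun v : I → A => s.restrict v)).card :=
      Finset.card_pos.2 ⟨s.restrict v,
        Finset.mem_image.2 ⟨v, Finset.mem_filter.2 ⟨Finset.mem_univ v, rfl⟩, rfl⟩⟩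
    have hc := card_image_restrict_fiber_le f s v
    have hlog : ((s.card : ℝ) - (determinedCoords f s v).card) * Real.log (Fintype.card A) =
        Real.log ((Fintype.card A ^ (s.card - (determinedCoords f s v).card) : ℕ) : ℝ) := by
      rw [Nat.cast_pow, Real.log_pow,
        Nat.cast_sub (Finset.card_le_card (determinedCoords_subset f s v))]
    rw [hlog]
    refine Real.log_le_log (Nat.cast_pos.2 hpos) (Nat.cast_le.2 ?_)
    convert hc
  have h3 : fiberEntropy f - fiberEntropy (fun v => (f v, s.restrict v)) ≤
      ∑ v : I → A, ((s.card : ℝ) - (determinedCoords f s v).card) * Real.log (Fintype.card A) := by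
    refine h.trans (Finset.sum_le_sum fun v _ => le_trans (le_of_eq ?_) (h2 v))
    congr!
  have h4 : ∑ v : I → A, ((s.card : ℝ) - (determinedCoords f s v).card) *
        Real.log (Fintype.card A) = Fintype.card (I → A) * (s.card * Real.log (Fintype.card A)) -
          (∑ v, ((determinedCoords f s v).card : ℝ)) * Real.log (Fintype.card A) := by
    rw [← Finset.sum_mul, Finset.sum_sub_distrib, Finset.sum_const, nsmul_eq_mul,
      Finset.card_univ]
    ring
  linarith

end CoordinateFibers

/-! ### Entropy of channel inputs for a fixed erasure pattern -/

section ErasureChannel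

variable {V A : Type*}

/-- What is seen before slot `k` of the inputs `x 1, x 2, …` by a receiver that is reached in the
slots marked by `b`. -/
def seen (x : ℕ → V → A) (b : ℕ → Bool) (k : ℕ) (v : V) (j : ℕ) : Option A :=
  if (1 ≤ j ∧ j < k) ∧ b j = true then some (x j v) else none

theorem seen_eq_iff {x : ℕ → V → A} {b : ℕ → Bool} {k : ℕ} {u v : V} :
    seen x b k u = seen x b k v ↔ ∀ j, 1 ≤ j → j < k → b j = true → x j u = x j v := by
  simp only [funext_iff, seen]
  refine forall_congr' fun j => ?_
  by_cases h : (1 ≤ j ∧ j < k) ∧ b j = true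
  · simp [h]
  · simp only [h, if_false, true_iff]
    exact fun h1 h2 h3 => absurd ⟨⟨h1, h2⟩, h3⟩ h

variable [Fintype V] {α : Type*}

/-- The conditional entropy of the input of slot `k` given `g` and what was seen before. -/
noncomputable def inputEntropy (x : ℕ → V → A) (g : V → α) (b : ℕ → Bool) (k : ℕ) : ℝ :=
  fiberEntropy (fun v => (g v, seen x b k v)) -
    fiberEntropy (fun v => ((g v, seen x b k v), x k v))

theorem inputEntropy_le [Fintype A] (x : ℕ → V → A) (g : V → α) (b : ℕ → Bool) (k : ℕ) :
    inputEntropy x g b k ≤ Fintype.card V * Real.log (Fintype.card A) :=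
  fiberEntropy_sub_le _ _

/-- A receiver that sees more has less uncertainty about the next input. -/
theorem inputEntropy_anti (x : ℕ → V → A) (g : V → α) {b b' : ℕ → Bool}
    (h : ∀ j, b j = true → b' j = true) (k : ℕ) :
    inputEntropy x g b' k ≤ inputEntropy x g b k := by
  have key := fiberEntropy_submodular (fun v => (g v, seen x b k v)) (seen x b' k) (x k)
  have hs : ∀ u v, seen x b' k u = seen x b' k v → seen x b k u = seen x b k v := by
    intro u v huv
    rw [seen_eq_iff] at huv ⊢
    exact fun j h1 h2 h3 => huv j h1 h2 (h j h3)
  have e1 : fiberEntropy (fun v => ((g v, seen x b k v), seen x b' k v)) =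
      fiberEntropy (fun v => (g v, seen x b' k v)) := by
    refine fiberEntropy_congr fun u v => ?_
    simp only [Prod.mk.injEq]
    have := hs u v
    tauto
  have e2 : fiberEntropy (fun v => (((g v, seen x b k v), seen x b' k v), x k v)) =
      fiberEntropy (fun v => ((g v, seen x b' k v), x k v)) := by
    refine fiberEntropy_congr fun u v => ?_
    simp only [Prod.mk.injEq]
    have := hs u v
    tauto
  unfold inputEntropy
  linarith

/-- The chain rule for the entropy of what is seen. -/
theorem fiberEntropy_sub_seen (x : ℕ → V → A) (g : V → α) (b : ℕ → Bool) (T : ℕ) :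
    fiberEntropy g - fiberEntropy (fun v => (g v, seen x b (T + 1) v)) =
      ∑ k ∈ Finset.Icc 1 T, if b k = true then inputEntropy x g b k else 0 := by
  induction T with
  | zero =>
    have : fiberEntropy (fun v => (g v, seen x b (0 + 1) v)) = fiberEntropy g := by
      refine fiberEntropy_congr fun u v => ?_
      simp only [Prod.mk.injEq, seen_eq_iff]
      refine and_iff_left ?_
      intro j h1 h2
      omega
    simp [this]
  | succ T ih =>
    rw [Finset.sum_Icc_succ_top (by omega), ← ih]
    split_ifs with hb
    · have : fiberEntropy (fun v => (g v, seen x b (T + 1 + 1) v)) =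
          fiberEntropy (fun v => ((g v, seen x b (T + 1) v), x (T + 1) v)) := by
        refine fiberEntropy_congr fun u v => ?_
        simp only [Prod.mk.injEq, seen_eq_iff, and_assoc]
        refine and_congr_right fun _ => ⟨fun h => ⟨fun j h1 h2 => h j h1 (by omega),
          h _ (by omega) (by omega) hb⟩, fun h j h1 h2 h3 => ?_⟩
        rcases Nat.lt_succ_iff_lt_or_eq.1 h2 with h2 | rfl
        · exact h.1 j h1 h2 h3
        · exact h.2
      rw [inputEntropy, this]
      ring
    · have : fiberEntropy (fun v => (g v, seen x b (T + 1 + 1) v)) =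
          fiberEntropy (fun v => (g v, seen x b (T + 1) v)) := by
        refine fiberEntropy_congr fun u v => ?_
        simp only [Prod.mk.injEq, seen_eq_iff]
        refine and_congr_right fun _ => ⟨fun h j h1 h2 => h j h1 (by omega), fun h j h1 h2 h3 => ?_⟩
        rcases Nat.lt_succ_iff_lt_or_eq.1 h2 with h2 | rfl
        · exact h j h1 h2 h3
        · exact absurd h3 hb
      rw [this]
      ring

end ErasureChannel

/-! ### Decoded packets versus input entropy -/

section Decoding

variable {I A : Type*} [Fintype I] [DecidableEq I] [Fintype A]

theorem fiberEntropy_restrict_sub {o a : Finset I} (h : Disjoint o a) :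
    fiberEntropy (fun v : I → A => o.restrict v) -
      fiberEntropy (fun v : I → A => (o ∪ a).restrict v) =
      Fintype.card (I → A) * (a.card * Real.log (Fintype.card A)) := by
  rw [fiberEntropy_restrict, fiberEntropy_restrict, Finset.card_union_of_disjoint h]
  push_cast
  ring

omit [Fintype I] [DecidableEq I] [Fintype A] in
theorem restrict_eq_iff {s : Finset I} {u v : I → A} :
    s.restrict u = s.restrict v ↔ ∀ i ∈ s, u i = v i := by
  simp [funext_iff, Finset.restrict]

/-- What a receiver decodes is limited by the input entropy lost when the packets `a` are known. -/
theorem sum_card_determinedCoords_seen_le (x : ℕ → (I → A) → A) (b : ℕ → Bool) (T : ℕ)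
    {o a : Finset I} (hoa : Disjoint o a) :
    (∑ v, ((determinedCoords (fun v => (o.restrict v, seen x b (T + 1) v)) a v).card : ℝ)) *
        Real.log (Fintype.card A) ≤
      ∑ k ∈ Finset.Icc 1 T, if b k = true then
        Fintype.card (I → A) * Real.log (Fintype.card A) -
          inputEntropy x (fun v => (o ∪ a).restrict v) b k else 0 := by
  -- The Fano bound is the information about `a` given `o`. By `h2` and `h5` it is a difference of
  -- two output entropies, without and with `a` known; the chain rule expands both, and the first is
  -- at most log |A| per reached slot.
  have h1 := sum_card_determinedCoords_le (fun v => (o.restrict v, seen x b (T + 1) v)) a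
  have h2 := fiberEntropy_restrict_sub (A := A) hoa
  have h3 := fiberEntropy_sub_seen x (fun v => o.restrict v) b T
  have h4 := fiberEntropy_sub_seen x (fun v => (o ∪ a).restrict v) b T
  have h5 : fiberEntropy (fun v => ((o.restrict v, seen x b (T + 1) v), a.restrict v)) =
      fiberEntropy (fun v => ((o ∪ a).restrict v, seen x b (T + 1) v)) := by
    refine fiberEntropy_congr fun u v => ?_
    simp only [Prod.mk.injEq, restrict_eq_iff, Finset.mem_union, or_imp, forall_and]
    tauto
  have h6 : (∑ k ∈ Finset.Icc 1 T, if b k = true then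
        inputEntropy x (fun v => o.restrict v) b k else 0) -
      (∑ k ∈ Finset.Icc 1 T, if b k = true then
        inputEntropy x (fun v => (o ∪ a).restrict v) b k else 0) ≤
      ∑ k ∈ Finset.Icc 1 T, if b k = true then
        Fintype.card (I → A) * Real.log (Fintype.card A) -
          inputEntropy x (fun v => (o ∪ a).restrict v) b k else 0 := by
    rw [← Finset.sum_sub_distrib]
    refine Finset.sum_le_sum fun k _ => ?_
    split_ifs
    · linarith [inputEntropy_le x (fun v : I → A => o.restrict v) b k]
    · simp
  linarith

/-- What a receiver decodes is limited by the input entropy that a better receiver perceives when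
it knows all other packets. -/
theorem sum_card_determinedCoords_seen_le' (x : ℕ → (I → A) → A) {b b' : ℕ → Bool}
    (hb : ∀ j, b j = true → b' j = true) (T : ℕ) {o a c : Finset I}
    (hc : Disjoint (o ∪ a) c) (hoac : (o ∪ a) ∪ c = Finset.univ) :
    (∑ v, ((determinedCoords (fun v => (o.restrict v, seen x b (T + 1) v)) c v).card : ℝ)) *
        Real.log (Fintype.card A) ≤
      ∑ k ∈ Finset.Icc 1 T, if b' k = true then
          inputEntropy x (fun v => (o ∪ a).restrict v) b' k else 0 := by
  have h1 := sum_card_determinedCoords_le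
    (fun v => ((o ∪ a).restrict v, seen x b' (T + 1) v)) c
  have h2 := fiberEntropy_restrict_sub (A := A) hc
  have h4 := fiberEntropy_sub_seen x (fun v => (o ∪ a).restrict v) b' T
  -- With `c` added every packet is known, so both entropies vanish and nothing is subtracted from
  -- the chain rule sum.
  have h5 : fiberEntropy (fun v => (((o ∪ a).restrict v, seen x b' (T + 1) v), c.restrict v)) =
      fiberEntropy (fun v : I → A => ((o ∪ a) ∪ c).restrict v) := by
    rw [fiberEntropy_of_injective, fiberEntropy_of_injective]
    · intro u v huv
      rw [restrict_eq_iff, hoac] at huv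
      exact funext fun i => huv i (Finset.mem_univ i)
    · intro u v huv
      simp only [Prod.mk.injEq, restrict_eq_iff] at huv
      funext i
      have : i ∈ (o ∪ a) ∪ c := hoac ▸ Finset.mem_univ i
      rcases Finset.mem_union.1 this with hi | hi
      · exact huv.1.1 i hi
      · exact huv.2 i hi
  -- Giving the receiver the packets `a` and the outputs marked by `b'` can only enlarge the set of
  -- decoded packets.
  have h6 : ∑ v, ((determinedCoords (fun v => (o.restrict v, seen x b (T + 1) v)) c v).card : ℝ) ≤
      ∑ v, ((determinedCoords
        (fun v => ((o ∪ a).restrict v, seen x b' (T + 1) v)) c v).card : ℝ) := by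
    refine Finset.sum_le_sum fun v _ => Nat.cast_le.2 (Finset.card_le_card fun i hi => ?_)
    rw [mem_determinedCoords] at hi ⊢
    refine ⟨hi.1, fun u hu => hi.2 u ?_⟩
    simp only [Prod.mk.injEq, restrict_eq_iff, seen_eq_iff, Finset.mem_union] at hu ⊢
    exact ⟨fun i hi => hu.1 i (Or.inl hi), fun j h1 h2 h3 => hu.2 j h1 h2 (hb j h3)⟩
  have h7 := mul_le_mul_of_nonneg_right h6 (Real.log_natCast_nonneg (Fintype.card A))
  linarith

end Decoding

/-! ### Lower bound on the sum of an age process with given resets -/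

section SumOfAges

/-- The age process that grows by one in every slot and is reset to one after the slots in `D`. -/
def resetAge (D : ℕ → Prop) [DecidablePred D] : ℕ → ℕ
  -- Index 0 is a dummy; at slot 1 the age is 1, the smallest initial age allowed.
  | 0 => 0
  | k + 1 => if k = 0 then 1 else if D k then 1 else resetAge D k + 1

variable (D : ℕ → Prop) [DecidablePred D]

theorem resetAge_le (k : ℕ) : resetAge D k ≤ k := by
  induction k with
  | zero => simp [resetAge]
  | succ k ih =>
    rw [resetAge]
    split_ifs <;> omega

theorem resetAge_le_sub {t k : ℕ} (ht : 1 ≤ t) (hD : D t) (h : t < k) :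
    resetAge D k ≤ k - t := by
  induction k with
  | zero => omega
  | succ k ih =>
    rw [resetAge]
    rcases Nat.lt_succ_iff_lt_or_eq.1 h with h | rfl
    · have := ih h
      split_ifs <;> omega
    · split_ifs <;> omega

/-- The square `(age - l) ^ 2 / 2` is a potential: without a reset both sides grow equally, and a
reset leaves a surplus of `(age - l) ^ 2 / 2` evaluated before the reset. -/
theorem sum_resetAge_ge_aux (l : ℝ) (T : ℕ) :
    (l + 1 / 2) * (T + 1 : ℕ) -
        l ^ 2 / 2 * (1 + (((Finset.Icc 1 T).filter D).card : ℝ)) +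
        ((resetAge D (T + 1) : ℝ) - l) ^ 2 / 2 ≤
      ∑ k ∈ Finset.Icc 1 (T + 1), (resetAge D k : ℝ) := by
  induction T with
  | zero =>
    simp [resetAge]
    nlinarith
  | succ T ih =>
    rw [Finset.sum_Icc_succ_top (by omega)]
    have hfilter : (Finset.Icc 1 (T + 1)).filter D =
        if D (T + 1) then insert (T + 1) ((Finset.Icc 1 T).filter D)
        else (Finset.Icc 1 T).filter D := by
      rw [← Finset.filter_insert]
      congr 1
      ext j
      simp only [Finset.mem_insert, Finset.mem_Icc]
      omega
    have hnot : T + 1 ∉ (Finset.Icc 1 T).filter D := by simp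
    have hstep : resetAge D (T + 1 + 1) = if D (T + 1) then 1 else resetAge D (T + 1) + 1 := by
      rw [resetAge, if_neg (Nat.succ_ne_zero T)]
    rw [hfilter, hstep]
    push_cast at ih ⊢
    split_ifs with h
    · rw [Finset.card_insert_of_notMem hnot]
      push_cast
      nlinarith [sq_nonneg ((resetAge D (T + 1) : ℝ) - l)]
    · nlinarith

/-- Every reset lowers the sum of the ages by at most `l ^ 2 / 2` below `l + 1 / 2` per slot. -/
theorem sum_resetAge_ge (l : ℝ) (T : ℕ) :
    (l + 1 / 2) * T - l ^ 2 / 2 * (1 + (((Finset.Icc 1 T).filter D).card : ℝ)) ≤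
      ∑ k ∈ Finset.Icc 1 T, (resetAge D k : ℝ) := by
  rcases T with _ | T
  · simp
    positivity
  · refine le_trans ?_ (sum_resetAge_ge_aux D l T)
    have : (((Finset.Icc 1 T).filter D).card : ℝ) ≤ ((Finset.Icc 1 (T + 1)).filter D).card :=
      Nat.cast_le.2 (Finset.card_le_card (Finset.filter_subset_filter _
        (Finset.Icc_subset_Icc_right (by omega))))
    nlinarith [sq_nonneg l, sq_nonneg ((resetAge D (T + 1) : ℝ) - l)]

end SumOfAges

/-! ### Functions of finitely many slots and independence of the current erasures -/

section Channel

theorem DependsOn.exists_eq_comp_restrict {β : Type*} [Nonempty β] {s : Finset ℕ}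
    {g : Pattern → β} (hg : DependsOn g (s : Set ℕ)) :
    ∃ G : (s → Fin 2 → Bool) → β, g = G ∘ s.restrict :=
  dependsOn_iff_exists_comp.1 hg

/-- Such a function factors through a finite discrete space, which also yields integrability below.
-/
theorem DependsOn.measurable_pattern {s : Finset ℕ} {g : Pattern → ℝ}
    (hg : DependsOn g (s : Set ℕ)) : Measurable g := by
  obtain ⟨G, rfl⟩ := hg.exists_eq_comp_restrict
  exact (Measurable.of_discrete (f := G)).comp (Finset.measurable_restrict s)

variable {Ω : Type*} [MeasurableSpace Ω] {P : Measure Ω} [IsProbabilityMeasure P]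
  {Z : ℕ → Fin 2 → Ω → Bool}

theorem DependsOn.integrable_pattern {s : Finset ℕ} {g : Pattern → ℝ}
    (hg : DependsOn g (s : Set ℕ)) (hZ : ∀ k i, Measurable (Z k i)) :
    Integrable (fun ω => g fun k i => Z k i ω) P := by
  have hm : Measurable fun ω => g fun k i => Z k i ω :=
    hg.measurable_pattern.comp (measurable_pi_iff.2 fun k => measurable_pi_iff.2 fun i => hZ k i)
  obtain ⟨G, rfl⟩ := hg.exists_eq_comp_restrict
  obtain ⟨C, hC⟩ := (Set.finite_range fun y => ‖G y‖).bddAbove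
  exact Integrable.of_bound hm.aestronglyMeasurable C
    (ae_of_all _ fun ω => hC ⟨_, rfl⟩)

omit [IsProbabilityMeasure P] in
/-- The erasures of a slot are independent of the past. -/
theorem integral_ite_channel_mul (hZ : ∀ k i, Measurable (Z k i))
    (hind : iIndepFun (fun (k : ℕ) (ω : Ω) (i : Fin 2) => Z k i ω) P) (k : ℕ)
    {g : Pattern → ℝ} (hg : DependsOn g (Finset.range k : Set ℕ)) (b : (Fin 2 → Bool) → Bool) :
    ∫ ω, (if b (fun i => Z k i ω) = true then g (fun k i => Z k i ω) else 0) ∂P =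
      P.real {ω | b (fun i => Z k i ω) = true} * ∫ ω, g (fun k i => Z k i ω) ∂P := by
  obtain ⟨G, rfl⟩ := hg.exists_eq_comp_restrict
  have hZ' : ∀ k, Measurable fun (ω : Ω) (i : Fin 2) => Z k i ω :=
    fun k => measurable_pi_iff.2 fun i => hZ k i
  have hi := hind.indepFun_finset {k} (Finset.range k) (by simp) hZ'
  have hb : Measurable fun y : ({k} : Finset ℕ) → Fin 2 → Bool =>
    if b (y ⟨k, by simp⟩) = true then (1 : ℝ) else 0 := Measurable.of_discrete
  have hi2 := hi.comp hb (Measurable.of_discrete (f := G))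
  have hset : MeasurableSet {ω | b (fun i => Z k i ω) = true} :=
    hZ' k (MeasurableSet.of_discrete (s := {y | b y = true}))
  have h := hi2.integral_fun_mul_eq_mul_integral
    (hb.comp (measurable_pi_iff.2 fun j => hZ' j)).aestronglyMeasurable
    ((Measurable.of_discrete (f := G)).comp
      (measurable_pi_iff.2 fun j => hZ' j)).aestronglyMeasurable
  have h1 : ∫ ω, (if b (fun i => Z k i ω) = true then (1 : ℝ) else 0) ∂P =
      P.real {ω | b (fun i => Z k i ω) = true} := by
    rw [← integral_indicator_one hset]
    refine integral_congr_ae (ae_of_all _ fun ω => ?_)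
    simp [Set.indicator_apply]
  rw [← h1]
  refine Eq.trans (integral_congr_ae (ae_of_all _ fun ω => ?_)) h
  simp only [Function.comp_apply, ite_mul, one_mul, zero_mul]
  rfl

end Channel

/-! ### The outer bound for a deterministic encoder with feedback -/

section Converse

variable {I A : Type*} [Fintype I] [DecidableEq I] [Fintype A]

/-- The slots in which the pattern `z` reaches user `i`. -/
def reached (i : Fin 2) (z : Pattern) (j : ℕ) : Bool := z j i

/-- The slots in which the pattern `z` reaches at least one user. -/
def reachedAny (z : Pattern) (j : ℕ) : Bool := z j 0 || z j 1

theorem reachedAny_of_reached (i : Fin 2) (z : Pattern) (j : ℕ) (h : reached i z j = true) :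
    reachedAny z j = true := by
  unfold reached at h
  unfold reachedAny
  fin_cases i <;> simp_all

omit [Fintype A] in
theorem seen_congr {V : Type*} {x x' : ℕ → V → A} {b b' : ℕ → Bool} {k : ℕ}
    (hx : ∀ j, 1 ≤ j → j < k → x j = x' j) (hb : ∀ j, j < k → b j = b' j) :
    seen x b k = seen x' b' k := by
  funext v j
  unfold seen
  by_cases h : 1 ≤ j ∧ j < k
  · rw [hx j h.1 h.2, hb j h.2]
  · simp [h]

omit [Fintype A] in
-- Feedback reveals only earlier erasures, so the input entropy is predictable and hence independent
-- of the erasures of slot `k`.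
theorem dependsOn_inputEntropy {V α : Type*} [Fintype V] {x : Pattern → ℕ → V → A}
    (hx : ∀ k, 1 ≤ k → DependsOn (fun z => x z k) (Finset.range k : Set ℕ)) (g : V → α)
    {b : Pattern → ℕ → Bool} (hb : ∀ z z' j, z j = z' j → b z j = b z' j) {k : ℕ} (hk : 1 ≤ k) :
    DependsOn (fun z => inputEntropy (x z) g (b z) k) (Finset.range k : Set ℕ) := by
  intro z z' h
  simp only [Finset.coe_range, Set.mem_Iio] at h
  have h1 : seen (x z) (b z) k = seen (x z') (b z') k := by
    refine seen_congr (fun j h1 h2 => hx j h1 fun l hl => h l ?_) fun j hj => hb z z' j (h j hj)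
    simp only [Finset.coe_range, Set.mem_Iio] at hl
    omega
  have h2 : x z k = x z' k := hx k hk fun l hl => h l (by simpa using hl)
  simp only [inputEntropy, h1, h2]

/-- The packets of the coordinates `s` decoded before slot `k` by a user that knows the coordinates
`o` and is reached in the slots marked by `b`. -/
noncomputable def decoded (x : ℕ → (I → A) → A) (b : ℕ → Bool) (k : ℕ) (o s : Finset I)
    (v : I → A) : Finset I :=
  determinedCoords (fun v => (o.restrict v, seen x b k v)) s v

theorem dependsOn_decoded {x : Pattern → ℕ → (I → A) → A}
    (hx : ∀ k, 1 ≤ k → DependsOn (fun z => x z k) (Finset.range k : Set ℕ))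
    (i : Fin 2) (T : ℕ) (o s : Finset I) (v : I → A) :
    DependsOn (fun z => decoded (x z) (reached i z) (T + 1) o s v)
      (Finset.range (T + 1) : Set ℕ) := by
  intro z z' h
  simp only [Finset.coe_range, Set.mem_Iio] at h
  have h1 : seen (x z) (reached i z) (T + 1) = seen (x z') (reached i z') (T + 1) := by
    refine seen_congr (fun j h1 h2 => hx j h1 fun l hl => h l ?_)
      fun j hj => by simp only [reached, h j hj]
    simp only [Finset.coe_range, Set.mem_Iio] at hl
    omega
  simp only [decoded, h1]

variable {Ω : Type*} [MeasurableSpace Ω] {P : Measure Ω} [IsProbabilityMeasure P]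
  {Z : ℕ → Fin 2 → Ω → Bool}

/-- The weight `g k` is settled before slot `k`, so the indicator of being reached factors out with
the same probability `δ` in every slot. -/
theorem integral_sum_reached (hZ : ∀ k i, Measurable (Z k i))
    (hind : iIndepFun (fun (k : ℕ) (ω : Ω) (i : Fin 2) => Z k i ω) P) {δ : ℝ}
    {b : (Fin 2 → Bool) → Bool} (hδ : ∀ k, P.real {ω | b (fun i => Z k i ω) = true} = δ)
    {g : ℕ → Pattern → ℝ} (hg : ∀ k, 1 ≤ k → DependsOn (g k) (Finset.range k : Set ℕ)) (T : ℕ) :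
    ∫ ω, ∑ k ∈ Finset.Icc 1 T,
        (if b (fun i => Z k i ω) = true then g k (fun k i => Z k i ω) else 0) ∂P =
      δ * ∑ k ∈ Finset.Icc 1 T, ∫ ω, g k (fun k i => Z k i ω) ∂P := by
  rw [integral_finsetSum, Finset.mul_sum]
  · refine Finset.sum_congr rfl fun k hk => ?_
    rw [integral_ite_channel_mul hZ hind k (hg k (Finset.mem_Icc.1 hk).1), hδ]
  · intro k hk
    refine DependsOn.integrable_pattern (s := Finset.range (k + 1))
      (g := fun z => if b (z k) = true then g k z else 0) (fun z z' h => ?_) hZ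
    simp only [Finset.coe_range, Set.mem_Iio] at h
    have h1 : g k z = g k z' := hg k (Finset.mem_Icc.1 hk).1 fun l hl => h l (by
      simp only [Finset.coe_range, Set.mem_Iio] at hl
      omega)
    simp only [h1, h k (Nat.lt_succ_self k)]

/-- The outer bound on the numbers of packets that the two users can decode, for the order of the
users in which `i` is the weaker receiver. -/
theorem weighted_integral_card_decoded_le [Nontrivial A] (hZ : ∀ k i, Measurable (Z k i))
    (hind : iIndepFun (fun (k : ℕ) (ω : Ω) (i : Fin 2) => Z k i ω) P)
    {x : Pattern → ℕ → (I → A) → A}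
    (hx : ∀ k, 1 ≤ k → DependsOn (fun z => x z k) (Finset.range k : Set ℕ))
    {i j : Fin 2} {δ δ' : ℝ} (hδ_nonneg : 0 ≤ δ) (hδ_nonneg' : 0 ≤ δ')
    (hδ : ∀ k, P.real {ω | Z k i ω = true} = δ)
    (hδ' : ∀ k, P.real {ω | (Z k 0 ω || Z k 1 ω) = true} = δ')
    {o a c : Finset I} (ha : Disjoint o a) (hc : Disjoint (o ∪ a) c)
    (hoac : (o ∪ a) ∪ c = Finset.univ) (T : ℕ) :
    δ' * (∫ ω, ∑ v, ((decoded (x fun k i => Z k i ω) (reached i fun k i => Z k i ω)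
        (T + 1) o a v).card : ℝ) ∂P) +
      δ * (∫ ω, ∑ v, ((decoded (x fun k i => Z k i ω) (reached j fun k i => Z k i ω)
        (T + 1) o c v).card : ℝ) ∂P) ≤
      Fintype.card (I → A) * (T * (δ' * δ)) := by
  have hlog : 0 < Real.log (Fintype.card A) :=
    Real.log_pos (by exact_mod_cast Fintype.one_lt_card)
  set N : ℝ := ((Fintype.card (I → A) : ℕ) : ℝ)
  set l : ℝ := Real.log ((Fintype.card A : ℕ) : ℝ)
  have hdep : ∀ (i : Fin 2) (s : Finset I), DependsOn
      (fun z => (∑ v, ((decoded (x z) (reached i z) (T + 1) o s v).card : ℝ)) * l)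
      (Finset.range (T + 1) : Set ℕ) := by
    intro i s z z' h
    simp only [dependsOn_decoded hx i T o s _ h]
  set βw : ℕ → Pattern → ℝ :=
    fun k z => inputEntropy (x z) (fun v => (o ∪ a).restrict v) (reached i z) k
  set βs : ℕ → Pattern → ℝ :=
    fun k z => inputEntropy (x z) (fun v => (o ∪ a).restrict v) (reachedAny z) k
  have hβw : ∀ k, 1 ≤ k → DependsOn (βw k) (Finset.range k : Set ℕ) := fun k hk =>
    dependsOn_inputEntropy hx _ (fun z z' j h => by simp only [reached, h]) hk
  have hβs : ∀ k, 1 ≤ k → DependsOn (βs k) (Finset.range k : Set ℕ) := fun k hk =>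
    dependsOn_inputEntropy hx _ (fun z z' j h => by simp only [reachedAny, h]) hk
  have hβw' : ∀ k, 1 ≤ k → DependsOn (fun z => N * l - βw k z) (Finset.range k : Set ℕ) :=
    fun k hk z z' h => by simp only [hβw k hk h]
  have hite : ∀ (b : (Fin 2 → Bool) → Bool) (g : ℕ → Pattern → ℝ),
      (∀ k, 1 ≤ k → DependsOn (g k) (Finset.range k : Set ℕ)) →
      DependsOn (fun z : Pattern => ∑ k ∈ Finset.Icc 1 T, if b (z k) = true then g k z else 0)
        (Finset.range (T + 1) : Set ℕ) := by
    intro b g hg z z' h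
    refine Finset.sum_congr rfl fun k hk => ?_
    simp only [Finset.coe_range, Set.mem_Iio] at h
    rw [Finset.mem_Icc] at hk
    rw [h k (by omega), hg k hk.1 fun l hl => h l (by
      simp only [Finset.coe_range, Set.mem_Iio] at hl
      omega)]
  have h1 := integral_mono (μ := P) ((hdep i a).integrable_pattern hZ)
    ((hite (fun y => y i) _ hβw').integrable_pattern hZ)
    (fun ω => sum_card_determinedCoords_seen_le (x fun k i => Z k i ω)
      (reached i fun k i => Z k i ω) T ha)
  have h2 := integral_mono (μ := P) ((hdep j c).integrable_pattern hZ)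
    ((hite (fun y => y 0 || y 1) _ hβs).integrable_pattern hZ)
    (fun ω => sum_card_determinedCoords_seen_le' (x fun k i => Z k i ω)
      (reachedAny_of_reached j _) T hc hoac)
  replace h1 := h1.trans_eq (integral_sum_reached (b := fun y => y i) hZ hind hδ hβw' T)
  replace h2 := h2.trans_eq (integral_sum_reached (b := fun y => y 0 || y 1) hZ hind hδ' hβs T)
  rw [integral_mul_const] at h1 h2
  -- What user `i` can gain and what the strengthened user `j` can gain share a budget of `N * l`
  -- per slot, because `βs ≤ βw`.
  have h3 : ∑ k ∈ Finset.Icc 1 T, ∫ ω, (N * l - βw k fun k i => Z k i ω) ∂P +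
      ∑ k ∈ Finset.Icc 1 T, ∫ ω, (βs k fun k i => Z k i ω) ∂P ≤ T * (N * l) := by
    rw [← Finset.sum_add_distrib]
    calc _ ≤ ∑ _k ∈ Finset.Icc 1 T, N * l := Finset.sum_le_sum fun k hk => ?_
      _ = _ := by simp
    have hk := (Finset.mem_Icc.1 hk).1
    rw [← integral_add ((hβw' k hk).integrable_pattern hZ) ((hβs k hk).integrable_pattern hZ)]
    calc _ ≤ ∫ _ω, N * l ∂P := integral_mono
          (((hβw' k hk).integrable_pattern hZ).add ((hβs k hk).integrable_pattern hZ))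
          (integrable_const _) fun ω => ?_
      _ = N * l := by simp
    have := inputEntropy_anti (x fun k i => Z k i ω) (fun v => (o ∪ a).restrict v)
      (reachedAny_of_reached i fun k i => Z k i ω) k
    simp only [βw, βs, Pi.add_apply]
    linarith
  -- The weights `δ'` and `δ` give both sums the common factor `δ * δ'`, so that `h3` applies; the
  -- factor log |A| then cancels.
  refine le_of_mul_le_mul_right ?_ hlog
  have h4 := mul_le_mul_of_nonneg_left h1 hδ_nonneg'
  have h5 := mul_le_mul_of_nonneg_left h2 hδ_nonneg
  have h6 := mul_le_mul_of_nonneg_left h3 (mul_nonneg hδ_nonneg hδ_nonneg')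
  unfold decoded
  simp only [decoded] at h4 h5
  linarith

end Converse

/-! ### Restriction to the finitely many packets available up to the horizon -/

section Window

/-- The packets that are available in the slots `1, …, T`. -/
abbrev Window (past T : ℕ) := Fin 2 × Finset.Ioc (-(past : ℤ)) (T : ℤ)

variable {A : Type*} {past T : ℕ}

/-- The contents of the available packets. -/
def Packets.window (past T : ℕ) (w : Packets A) : Window past T → A := fun p => w p.1 p.2

open Classical in
/-- An assignment of contents to all packets with given contents of the available ones. -/
noncomputable def extendWindow [Nonempty A] (v : Window past T → A) : Packets A := fun i t =>
  if h : t ∈ Finset.Ioc (-(past : ℤ)) (T : ℤ) then v (i, ⟨t, h⟩) else Classical.arbitrary A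

theorem extendWindow_apply [Nonempty A] (v : Window past T → A) (i : Fin 2) {t : ℤ}
    (h : t ∈ Finset.Ioc (-(past : ℤ)) (T : ℤ)) : extendWindow v i t = v (i, ⟨t, h⟩) :=
  dif_pos h

/-- The packets generated before slot `1`. -/
noncomputable def oldPackets (past T : ℕ) : Finset (Window past T) :=
  Finset.univ.filter fun p => (p.2 : ℤ) ≤ 0

/-- The packets of user `i` generated in the slots `1, …, T`. -/
noncomputable def newPackets (past T : ℕ) (i : Fin 2) : Finset (Window past T) :=
  Finset.univ.filter fun p => p.1 = i ∧ 0 < (p.2 : ℤ)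

theorem disjoint_oldPackets (i : Fin 2) :
    Disjoint (oldPackets past T) (newPackets past T i) := by
  rw [Finset.disjoint_left]
  intro p hp hp'
  simp only [oldPackets, newPackets, Finset.mem_filter, Finset.mem_univ, true_and] at hp hp'
  omega

theorem disjoint_newPackets {i j : Fin 2} (hij : i ≠ j) :
    Disjoint (oldPackets past T ∪ newPackets past T i) (newPackets past T j) := by
  rw [Finset.disjoint_union_left]
  refine ⟨disjoint_oldPackets j, ?_⟩
  rw [Finset.disjoint_left]
  intro p hp hp'
  simp only [newPackets, Finset.mem_filter, Finset.mem_univ, true_and] at hp hp'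
  exact hij (hp.1.symm.trans hp'.1)

theorem union_newPackets {i j : Fin 2} (hij : i ≠ j) :
    (oldPackets past T ∪ newPackets past T i) ∪ newPackets past T j = Finset.univ := by
  refine Finset.eq_univ_of_forall fun p => ?_
  simp only [oldPackets, newPackets, Finset.mem_union, Finset.mem_filter, Finset.mem_univ,
    true_and]
  have : p.1 = i ∨ p.1 = j := by omega
  rcases le_or_gt (p.2 : ℤ) 0 with h | h <;> tauto

end Window

/-! ### Received packets, ages and measurability for a policy -/

namespace Policy

variable {A Θ : Type*} [MeasurableSpace A] [MeasurableSpace Θ] {S : InitialState A}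

/-- The channel inputs as functions of the available packets. -/
noncomputable def windowInput [Nonempty A] (π : Policy A Θ S) (T : ℕ) (θ : Θ) (z : Pattern) (k : ℕ)
    (v : Window S.past T → A) : A :=
  π.input k θ (extendWindow v) z

theorem windowInput_window [Nonempty A] (π : Policy A Θ S) {T : ℕ} (θ : Θ) (z : Pattern) {k : ℕ}
    (hk : k ≤ T) (w : Packets A) :
    π.windowInput T θ z k (w.window S.past T) = π.input k θ w z := by
  refine π.causal k θ _ _ z z (fun i t h1 h2 => ?_) fun _ _ _ => rfl
  rw [extendWindow_apply _ _ (Finset.mem_Ioc.2 ⟨h1, by omega⟩)]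
  rfl

theorem dependsOn_windowInput [Nonempty A] (π : Policy A Θ S) (T : ℕ) (θ : Θ) (k : ℕ) :
    DependsOn (fun z => π.windowInput T θ z k) (Finset.range k : Set ℕ) := by
  intro z z' h
  funext v
  exact π.causal k θ _ _ z z' (fun _ _ _ _ => rfl) fun j _ hj => h j (by simpa using hj)

variable [Fintype A] [Nonempty A]

/-- The packets of user `i` generated and decoded in the slots `1, …, T` when the old packets are
known. -/
noncomputable def decodedWindow (π : Policy A Θ S) (i : Fin 2) (T : ℕ) (θ : Θ) (z : Pattern)
    (v : Window S.past T → A) : Finset (Window S.past T) :=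
  decoded (π.windowInput T θ z) (reached i z) (T + 1) (oldPackets S.past T)
    (newPackets S.past T i) v

/-- What is determined before slot `k` stays determined at the horizon, when more outputs and all
old packets are known. -/
theorem mem_decodedWindow_of_received (π : Policy A Θ S) {i : Fin 2} {k T : ℕ} {θ : Θ}
    {w : Packets A} {z : Pattern} {t : ℤ} (hk : k ≤ T) (ht : 0 < t) (htk : t < k)
    (h : π.Received i k θ w z t) :
    ∃ p ∈ π.decodedWindow i T θ z (w.window S.past T), (p.2 : ℤ) = t := by
  have htm : t ∈ Finset.Ioc (-(S.past : ℤ)) (T : ℤ) := Finset.mem_Ioc.2 ⟨by omega, by omega⟩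
  refine ⟨(i, ⟨t, htm⟩), ?_, rfl⟩
  rw [decodedWindow, decoded, mem_determinedCoords]
  refine ⟨by simp [newPackets, ht], fun u hu => ?_⟩
  simp only [Prod.mk.injEq, restrict_eq_iff, seen_eq_iff] at hu
  have h1 := h (extendWindow u) ?_ ?_
  · rw [extendWindow_apply _ _ htm] at h1
    exact h1
  -- The initial side information is a function of the old packets.
  · refine S.side_old i _ _ fun j s hs hs0 => ?_
    have hsm : s ∈ Finset.Ioc (-(S.past : ℤ)) (T : ℤ) := Finset.mem_Ioc.2 ⟨hs, by omega⟩
    rw [extendWindow_apply _ _ hsm]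
    exact hu.1 (j, ⟨s, hsm⟩) (by simp [oldPackets, hs0])
  · intro j hj1 hjk
    unfold output
    split_ifs with hz
    · have := hu.2 j hj1 (by omega) hz
      rw [windowInput_window π θ z (by omega) w] at this
      exact congrArg some this
    · rfl

open Classical in
/-- The sum of the ages is large when few packets are decoded. -/
theorem sum_age_ge (π : Policy A Θ S) (i : Fin 2) (T : ℕ) (θ : Θ) (w : Packets A) (z : Pattern)
    (l : ℝ) :
    (l + 1 / 2) * T -
        l ^ 2 / 2 * (1 + ((π.decodedWindow i T θ z (w.window S.past T)).card : ℝ)) ≤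
      ∑ k ∈ Finset.Icc 1 T, (π.age i k θ w z : ℝ) := by
  set E := π.decodedWindow i T θ z (w.window S.past T)
  -- A packet decoded at any time up to the horizon is credited right after its generation slot,
  -- which can only lower the age.
  set D : ℕ → Prop := fun t => ∃ p ∈ E, (p.2 : ℤ) = t with hD
  have hcard : ((Finset.Icc 1 T).filter D).card ≤ E.card := by
    have : (Finset.Icc 1 T).filter D ⊆ E.image fun p => (p.2 : ℤ).toNat := by
      intro t ht
      obtain ⟨p, hp, hpt⟩ := (Finset.mem_filter.1 ht).2
      exact Finset.mem_image.2 ⟨p, hp, by simp [hpt]⟩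
    exact (Finset.card_le_card this).trans Finset.card_image_le
  have hage : ∀ k ∈ Finset.Icc 1 T, resetAge D k ≤ π.age i k θ w z := by
    intro k hk
    rw [Finset.mem_Icc] at hk
    have hpos := S.age_pos i
    refine le_csInf ⟨S.age i + k - 1, Or.inl (by omega)⟩ ?_
    rintro a (ha | ⟨t, htk, hrec, ha⟩)
    -- Packets from before slot 1, including the one given initially, have age at least `k`, which
    -- no `resetAge` exceeds.
    · have := resetAge_le D k
      omega
    · rcases le_or_gt t 0 with ht | ht
      · have := resetAge_le D k
        omega
      · obtain ⟨p, hp, hpt⟩ := π.mem_decodedWindow_of_received hk.2 ht htk hrec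
        have := resetAge_le_sub D (t := t.toNat) (k := k) (by omega) ⟨p, hp, by omega⟩ (by omega)
        omega
  calc _ ≤ (l + 1 / 2) * T - l ^ 2 / 2 * (1 + (((Finset.Icc 1 T).filter D).card : ℝ)) := by
        have : (((Finset.Icc 1 T).filter D).card : ℝ) ≤ E.card := by exact_mod_cast hcard
        nlinarith [sq_nonneg l]
    _ ≤ _ := sum_resetAge_ge D l T
    _ ≤ _ := Finset.sum_le_sum fun k hk => Nat.cast_le.2 (hage k hk)

theorem decodedWindow_congr {π : Policy A Θ S} {i : Fin 2} {T : ℕ} {θ : Θ} {z z' : Pattern}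
    (h : ∀ j < T + 1, z j = z' j) (v : Window S.past T → A) :
    π.decodedWindow i T θ z v = π.decodedWindow i T θ z' v :=
  dependsOn_decoded (fun k _ => π.dependsOn_windowInput T θ k) i T _ _ v fun j hj =>
    h j (by simpa using hj)

variable [MeasurableSingletonClass A]

/-- For a fixed pattern the randomization enters only through finitely many input values. -/
theorem measurable_card_decodedWindow_left (π : Policy A Θ S) (i : Fin 2) (T : ℕ) (z : Pattern)
    (v : Window S.past T → A) :
    Measurable fun θ => ((π.decodedWindow i T θ z v).card : ℝ) := by
  let y : Θ → Fin (T + 1) → (Window S.past T → A) → A := fun θ j u => π.windowInput T θ z j u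
  have hy : Measurable y := measurable_pi_iff.2 fun j => measurable_pi_iff.2 fun u =>
    π.measurable_input j _ z
  let G : (Fin (T + 1) → (Window S.past T → A) → A) → ℝ := fun y =>
    ((decoded (fun j u => if h : j < T + 1 then y ⟨j, h⟩ u else Classical.arbitrary A)
      (reached i z) (T + 1) (oldPackets S.past T) (newPackets S.past T i) v).card : ℝ)
  have : (fun θ => ((π.decodedWindow i T θ z v).card : ℝ)) = G ∘ y := by
    funext θ
    simp only [Function.comp_apply, G, decodedWindow, decoded]
    rw [seen_congr (x := π.windowInput T θ z)
      (x' := fun j u => if h : j < T + 1 then y θ ⟨j, h⟩ u else Classical.arbitrary A)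
      (fun j _ hj => by funext u; simp [y, hj]) fun _ _ => rfl]
  rw [this]
  exact (Measurable.of_discrete (f := G)).comp hy

/-- Only slots up to `T` matter, so the pattern takes values in a finite set and joint measurability
follows from that in `θ`. -/
theorem measurable_card_decodedWindow (π : Policy A Θ S) (i : Fin 2) (T : ℕ)
    (v : Window S.past T → A) :
    Measurable fun p : Θ × Pattern => ((π.decodedWindow i T p.1 p.2 v).card : ℝ) := by
  let e : (Fin (T + 1) → Fin 2 → Bool) → Pattern := fun y j =>
    if h : j < T + 1 then y ⟨j, h⟩ else fun _ => false
  let r : Pattern → Fin (T + 1) → Fin 2 → Bool := fun z j => z j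
  have hr : Measurable r := measurable_pi_iff.2 fun j => measurable_pi_apply _
  have h1 : Measurable fun p : Θ × (Fin (T + 1) → Fin 2 → Bool) =>
      ((π.decodedWindow i T p.1 (e p.2) v).card : ℝ) :=
    measurable_from_prod_countable_left fun y => π.measurable_card_decodedWindow_left i T (e y) v
  have h2 := h1.comp (measurable_fst.prodMk (hr.comp measurable_snd) :
    Measurable fun p : Θ × Pattern => (p.1, r p.2))
  have h3 : ∀ p : Θ × Pattern,
      π.decodedWindow i T p.1 p.2 v = π.decodedWindow i T p.1 (e (r p.2)) v := fun p =>
    decodedWindow_congr (fun j hj => by simp only [e, r, hj, dif_pos]) v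
  simpa only [Function.comp_def, ← h3] using h2

end Policy

/-! ### Averaging over independent variables -/

section Independence

variable {Ω : Type*} [MeasurableSpace Ω] {P : Measure Ω} [IsProbabilityMeasure P]

/-- Fubini: it suffices to bound the integral with `X` frozen. This is how the randomization of the
policy is removed. -/
theorem integral_le_of_indepFun {E F : Type*} [MeasurableSpace E] [MeasurableSpace F]
    {X : Ω → E} {Y : Ω → F} (h : IndepFun X Y P) (hX : Measurable X) (hY : Measurable Y)
    {g : E × F → ℝ} (hg : Measurable g) {M : ℝ} (hM : ∀ p, ‖g p‖ ≤ M) {C : ℝ}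
    (hC : ∀ a, ∫ ω, g (a, Y ω) ∂P ≤ C) : ∫ ω, g (X ω, Y ω) ∂P ≤ C := by
  have := Measure.isProbabilityMeasure_map (μ := P) hX.aemeasurable
  have := Measure.isProbabilityMeasure_map (μ := P) hY.aemeasurable
  have hint : Integrable g ((P.map X).prod (P.map Y)) :=
    Integrable.of_bound hg.aestronglyMeasurable M (ae_of_all _ hM)
  have h1 : ∫ ω, g (X ω, Y ω) ∂P = ∫ p, g p ∂(P.map X).prod (P.map Y) := by
    rw [← (indepFun_iff_map_prod_eq_prod_map_map hX.aemeasurable hY.aemeasurable).1 h,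
      integral_map (hX.prodMk hY).aemeasurable hg.aestronglyMeasurable]
  rw [h1, integral_prod g hint]
  calc _ ≤ ∫ _a, C ∂P.map X := integral_mono hint.integral_prod_left (integrable_const _) fun a => ?_
    _ = C := by simp
  have hga : Measurable fun y => g (a, y) := hg.comp (measurable_const.prodMk measurable_id)
  rw [integral_map hY.aemeasurable hga.aestronglyMeasurable]
  exact hC a

/-- The average over a uniformly distributed variable that is independent of everything else. -/
theorem integral_uniform_of_indepFun {V F : Type*} [Fintype V] [MeasurableSpace V]
    [MeasurableSingletonClass V] [MeasurableSpace F] {X : Ω → V} {Y : Ω → F}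
    (h : IndepFun X Y P) (hX : Measurable X) (hY : Measurable Y) {q : ℝ}
    (hq : ∀ v, P.real {ω | X ω = v} = q) {u : V → F → ℝ} (hu : ∀ v, Measurable (u v))
    {M : ℝ} (hM : ∀ v y, ‖u v y‖ ≤ M) :
    ∫ ω, u (X ω) (Y ω) ∂P = q * ∫ ω, ∑ v, u v (Y ω) ∂P := by
  classical
  have hint : ∀ v, Integrable (fun ω => u v (Y ω)) P := fun v =>
    Integrable.of_bound ((hu v).comp hY).aestronglyMeasurable M (ae_of_all _ fun ω => hM v _)
  have hone : ∀ v, Measurable fun x : V => if x = v then (1 : ℝ) else 0 :=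
    fun v => Measurable.of_discrete
  have h1 : ∀ ω, u (X ω) (Y ω) = ∑ v, (if X ω = v then (1 : ℝ) else 0) * u v (Y ω) := by
    intro ω
    simp
  have h2 : ∀ v, ∫ ω, (if X ω = v then (1 : ℝ) else 0) * u v (Y ω) ∂P =
      q * ∫ ω, u v (Y ω) ∂P := by
    intro v
    have h3 : ∫ ω, (if X ω = v then (1 : ℝ) else 0) ∂P = q := by
      have hset : MeasurableSet {ω | X ω = v} := hX (measurableSet_singleton v)
      rw [← hq v, ← integral_indicator_one hset]
      refine integral_congr_ae (ae_of_all _ fun ω => ?_)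
      simp [Set.indicator_apply]
    rw [← h3]
    exact (h.comp (hone v) (hu v)).integral_fun_mul_eq_mul_integral
      ((hone v).comp hX).aestronglyMeasurable ((hu v).comp hY).aestronglyMeasurable
  simp only [h1]
  rw [integral_finsetSum, integral_finsetSum, Finset.mul_sum]
  · exact Finset.sum_congr rfl fun v _ => h2 v
  · exact fun v _ => hint v
  · intro v _
    refine Integrable.of_bound
      (((hone v).comp hX).mul ((hu v).comp hY)).aestronglyMeasurable M (ae_of_all _ fun ω => ?_)
    have hM' := hM v (Y ω)
    split_ifs
    · simpa using hM'
    · simpa using (norm_nonneg _).trans hM'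

end Independence

/-! ### The outer bound for randomized policies -/

namespace IsErasureModel

variable {Ω A Θ : Type*} [MeasurableSpace Ω] [Fintype A] [MeasurableSpace A] [MeasurableSpace Θ]
  {P : Measure Ω} [IsProbabilityMeasure P] {ε : Fin 2 → ℝ} {ε₁₂ : ℝ} {W : Fin 2 → ℤ → Ω → A}
  {Z : ℕ → Fin 2 → Ω → Bool} {θ : Ω → Θ}

theorem real_reached (h : IsErasureModel P ε ε₁₂ W Z θ) (k : ℕ) (i : Fin 2) :
    P.real {ω | Z k i ω = true} = 1 - ε i := by
  have hset : MeasurableSet {ω | Z k i ω = false} :=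
    h.measurable_channel k i (measurableSet_singleton false)
  rw [← h.erasure k i, ← probReal_compl_eq_one_sub hset]
  congr 1
  ext ω
  simp

theorem real_reachedAny (h : IsErasureModel P ε ε₁₂ W Z θ) (k : ℕ) :
    P.real {ω | (Z k 0 ω || Z k 1 ω) = true} = 1 - ε₁₂ := by
  have hset : MeasurableSet {ω | Z k 0 ω = false ∧ Z k 1 ω = false} :=
    (h.measurable_channel k 0 (measurableSet_singleton false)).inter
      (h.measurable_channel k 1 (measurableSet_singleton false))
  rw [← h.erasure_both k, ← probReal_compl_eq_one_sub hset]
  congr 1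
  ext ω
  simp only [Bool.or_eq_true, Set.mem_ofPred_eq, Set.mem_compl_iff]
  cases Z k 0 ω <;> cases Z k 1 ω <;> simp

theorem erasure_both_le (h : IsErasureModel P ε ε₁₂ W Z θ) : ε₁₂ ≤ ε 0 := by
  rw [← h.erasure_both 0, ← h.erasure 0 0]
  exact measureReal_mono fun ω hω => hω.1

omit [IsProbabilityMeasure P] in
theorem measurable_pattern (h : IsErasureModel P ε ε₁₂ W Z θ) :
    Measurable fun (ω : Ω) (k : ℕ) (i : Fin 2) => Z k i ω :=
  measurable_pi_iff.2 fun k => measurable_pi_iff.2 fun i => h.measurable_channel k i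

omit [IsProbabilityMeasure P] in
theorem measurable_window (h : IsErasureModel P ε ε₁₂ W Z θ) (past T : ℕ) :
    Measurable fun ω => Packets.window past T fun i t => W i t ω :=
  measurable_pi_iff.2 fun p => h.measurable_packet p.1 p.2

variable [MeasurableSingletonClass A]

omit [IsProbabilityMeasure P] in
theorem real_window_eq (h : IsErasureModel P ε ε₁₂ W Z θ) (past T : ℕ) (v : Window past T → A) :
    P.real {ω | Packets.window past T (fun i t => W i t ω) = v} =
      1 / (Fintype.card (Window past T → A) : ℝ) := by
  have hinj : Function.Injective fun p : Window past T => (p.1, (p.2 : ℤ)) := by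
    rintro ⟨i, t⟩ ⟨j, s⟩ hp
    simp only [Prod.mk.injEq] at hp
    exact Prod.ext hp.1 (Subtype.ext hp.2)
  have h1 := (h.indep_packet.precomp hinj).measure_inter_preimage_eq_mul Finset.univ
    (sets := fun p => {v p}) fun p _ => measurableSet_singleton _
  have h2 : {ω | Packets.window past T (fun i t => W i t ω) = v} =
      ⋂ p ∈ (Finset.univ : Finset (Window past T)), (fun ω => W p.1 p.2 ω) ⁻¹' {v p} := by
    ext ω
    simp [Packets.window, funext_iff]
  rw [h2, measureReal_def, h1, ENNReal.toReal_prod]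
  have h3 : ∀ p : Window past T, (P ((fun ω => W p.1 p.2 ω) ⁻¹' {v p})).toReal =
      1 / (Fintype.card A : ℝ) := fun p => h.uniform_packet p.1 p.2 (v p)
  rw [Finset.prod_congr rfl fun p _ => h3 p, Finset.prod_const, Fintype.card_fun]
  simp

variable [Nontrivial A] {S : InitialState A}

omit [MeasurableSingletonClass A] in
theorem norm_card_decodedWindow_le (π : Policy A Θ S) (i : Fin 2) (T : ℕ) (θ : Θ) (z : Pattern)
    (v : Window S.past T → A) :
    ‖((π.decodedWindow i T θ z v).card : ℝ)‖ ≤ Fintype.card (Window S.past T) := by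
  rw [Real.norm_of_nonneg (Nat.cast_nonneg _)]
  exact_mod_cast Finset.card_le_univ _

/-- The number of packets of user `i` generated and decoded in the slots `1, …, T`. -/
noncomputable def decodedCount (π : Policy A Θ S) (W : Fin 2 → ℤ → Ω → A)
    (Z : ℕ → Fin 2 → Ω → Bool) (θ : Ω → Θ) (i : Fin 2) (T : ℕ) (ω : Ω) : ℝ :=
  (π.decodedWindow i T (θ ω) (fun k i => Z k i ω)
    (Packets.window S.past T fun i t => W i t ω)).card

omit [IsProbabilityMeasure P] in
theorem measurable_decodedCount (h : IsErasureModel P ε ε₁₂ W Z θ) (π : Policy A Θ S) (i : Fin 2)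
    (T : ℕ) : Measurable (decodedCount π W Z θ i T) := by
  let g : (Window S.past T → A) × (Θ × Pattern) → ℝ := fun q =>
    ((π.decodedWindow i T q.2.1 q.2.2 q.1).card : ℝ)
  have h1 : Measurable g :=
    measurable_from_prod_countable_right fun v => π.measurable_card_decodedWindow i T v
  have h2 := (h.measurable_window S.past T).prodMk
    (h.measurable_random.prodMk h.measurable_pattern)
  have h3 := h1.comp h2
  exact h3

theorem integrable_decodedCount (h : IsErasureModel P ε ε₁₂ W Z θ) (π : Policy A Θ S) (i : Fin 2)
    (T : ℕ) : Integrable (decodedCount π W Z θ i T) P :=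
  Integrable.of_bound (h.measurable_decodedCount π i T).aestronglyMeasurable _
    (ae_of_all _ fun _ => norm_card_decodedWindow_le π i T _ _ _)

/-- The packets are uniform and independent of randomization and channel, which links the
expectation to the sums over `v` of the counting argument. -/
theorem integral_decodedCount (h : IsErasureModel P ε ε₁₂ W Z θ) (π : Policy A Θ S) (i : Fin 2)
    (T : ℕ) :
    ∫ ω, decodedCount π W Z θ i T ω ∂P = 1 / (Fintype.card (Window S.past T → A) : ℝ) *
      ∫ ω, ∑ v, ((π.decodedWindow i T (θ ω) (fun k i => Z k i ω) v).card : ℝ) ∂P := by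
  have hind : IndepFun (fun ω => Packets.window S.past T fun i t => W i t ω)
      (fun ω : Ω => (θ ω, fun (k : ℕ) (i : Fin 2) => Z k i ω)) P := by
    have hr : Measurable fun (w : Fin 2 × ℤ → A) (p : Window S.past T) => w (p.1, p.2) :=
      measurable_pi_iff.2 fun p => measurable_pi_apply _
    exact h.indep_packet_rest.comp hr measurable_id
  exact integral_uniform_of_indepFun hind (h.measurable_window S.past T)
    (h.measurable_random.prodMk h.measurable_pattern) (h.real_window_eq S.past T)
    (u := fun v p => ((π.decodedWindow i T p.1 p.2 v).card : ℝ))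
    (fun v => π.measurable_card_decodedWindow i T v)
    fun v p => norm_card_decodedWindow_le π i T p.1 p.2 v

theorem weighted_integral_decodedCount_le (h : IsErasureModel P ε ε₁₂ W Z θ) (π : Policy A Θ S)
    {i j : Fin 2} (hij : i ≠ j) (hε : ε i ≤ 1) (hε₁₂ : ε₁₂ ≤ 1) (T : ℕ) :
    (1 - ε₁₂) * ∫ ω, decodedCount π W Z θ i T ω ∂P +
      (1 - ε i) * ∫ ω, decodedCount π W Z θ j T ω ∂P ≤ T * ((1 - ε₁₂) * (1 - ε i)) := by
  set N : ℝ := ((Fintype.card (Window S.past T → A) : ℕ) : ℝ) with hN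
  have hNpos : 0 < N := by
    rw [hN]
    exact_mod_cast Fintype.card_pos
  set u : Fin 2 → Θ × Pattern → ℝ := fun i p =>
    ∑ v, ((π.decodedWindow i T p.1 p.2 v).card : ℝ) with hu
  have hum : ∀ i, Measurable (u i) := fun i =>
    Finset.measurable_sum _ fun v _ => π.measurable_card_decodedWindow i T v
  have hub : ∀ i p, ‖u i p‖ ≤ N * Fintype.card (Window S.past T) := fun i p => by
    refine (norm_sum_le _ _).trans ?_
    refine (Finset.sum_le_sum fun v _ => norm_card_decodedWindow_le π i T p.1 p.2 v).trans ?_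
    simp [hN]
  have hui : ∀ (i : Fin 2) {Y : Ω → Θ × Pattern}, Measurable Y →
      Integrable (fun ω => u i (Y ω)) P := fun i Y hY =>
    Integrable.of_bound ((hum i).comp hY).aestronglyMeasurable _ (ae_of_all _ fun _ => hub i _)
  have hY : Measurable fun ω : Ω => (θ ω, fun (k : ℕ) (i : Fin 2) => Z k i ω) :=
    h.measurable_random.prodMk h.measurable_pattern
  have hadd : ∀ {Y : Ω → Θ × Pattern}, Measurable Y →
      ∫ ω, ((1 - ε₁₂) * u i (Y ω) + (1 - ε i) * u j (Y ω)) ∂P =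
        (1 - ε₁₂) * ∫ ω, u i (Y ω) ∂P + (1 - ε i) * ∫ ω, u j (Y ω) ∂P := fun hY => by
    rw [integral_add ((hui i hY).const_mul _) ((hui j hY).const_mul _), integral_const_mul,
      integral_const_mul]
  have key : ∫ ω, ((1 - ε₁₂) * u i (θ ω, fun k i => Z k i ω) +
      (1 - ε i) * u j (θ ω, fun k i => Z k i ω)) ∂P ≤ N * (T * ((1 - ε₁₂) * (1 - ε i))) := by
    refine integral_le_of_indepFun h.indep_random_channel h.measurable_random h.measurable_pattern
      (g := fun p => (1 - ε₁₂) * u i p + (1 - ε i) * u j p)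
      (((hum i).const_mul _).add ((hum j).const_mul _))
      (M := ‖1 - ε₁₂‖ * (N * Fintype.card (Window S.past T)) +
        ‖1 - ε i‖ * (N * Fintype.card (Window S.past T))) (fun p => ?_) fun a => ?_
    · refine (norm_add_le _ _).trans ?_
      rw [norm_mul, norm_mul]
      gcongr
      · exact hub i p
      · exact hub j p
    · rw [hadd (measurable_const.prodMk h.measurable_pattern)]
      exact weighted_integral_card_decoded_le h.measurable_channel h.indep_channel
        (fun k _ => π.dependsOn_windowInput T a k) (by linarith) (by linarith)
        (fun k => h.real_reached k i) h.real_reachedAny (disjoint_oldPackets i)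
        (disjoint_newPackets hij) (union_newPackets hij) T
  rw [hadd hY] at key
  rw [h.integral_decodedCount π i T, h.integral_decodedCount π j T, ← hN]
  have h2 := mul_le_mul_of_nonneg_left key (by positivity : 0 ≤ 1 / N)
  have h3 : 1 / N * (N * (T * ((1 - ε₁₂) * (1 - ε i)))) = T * ((1 - ε₁₂) * (1 - ε i)) := by
    field_simp
  rw [h3] at h2
  refine le_trans (le_of_eq ?_) h2
  simp only [hu]
  ring

/-- The outer bound on the rates at which the two users can be served. -/
theorem sum_integral_decodedCount_le (h : IsErasureModel P ε ε₁₂ W Z θ) (hε : ∀ i, ε i < 1)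
    (π : Policy A Θ S) (T : ℕ) :
    ∑ i, (2 - ε₁₂ - ε (otherUser i)) * ∫ ω, decodedCount π W Z θ i T ω ∂P ≤
      T * ((1 - ε₁₂) * (2 - ε 0 - ε 1)) := by
  have hε₁₂ : ε₁₂ ≤ 1 := h.erasure_both_le.trans (hε 0).le
  have h1 := h.weighted_integral_decodedCount_le π zero_ne_one (hε 0).le hε₁₂ T
  have h2 := h.weighted_integral_decodedCount_le π one_ne_zero (hε 1).le hε₁₂ T
  have h3 : otherUser 0 = 1 := rfl
  have h4 : otherUser 1 = 0 := rfl
  -- Adding the two orders gives user `i` the coefficient (1 - ε₁₂) + (1 - ε_{other}).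
  rw [Fin.sum_univ_two, h3, h4]
  linarith

end IsErasureModel

/-! ### Passage to the limit -/

section Limits

variable {Ω : Type*} [MeasurableSpace Ω] {P : Measure Ω} [IsProbabilityMeasure P]

omit [IsProbabilityMeasure P] in
theorem ofReal_integral_le_lintegral_ofReal {f : Ω → ℝ} (hf : Integrable f P) :
    ENNReal.ofReal (∫ ω, f ω ∂P) ≤ ∫⁻ ω, ENNReal.ofReal (f ω) ∂P := by
  rw [integral_eq_lintegral_pos_part_sub_lintegral_neg_part hf]
  exact (ENNReal.ofReal_le_ofReal (sub_le_self _ ENNReal.toReal_nonneg)).trans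
    ENNReal.ofReal_toReal_le

/-- Lower bounds on the limiting expectation and on the expected limit of a sequence that is bounded
below by measurable functions which are uniformly bounded above. -/
theorem le_liminf_lintegral_and_le_lintegral_lim {J Q : ℕ → Ω → ℝ} {b M : ℝ} {c : ℕ → ℝ}
    (hQm : ∀ T, Measurable (Q T)) (hQi : ∀ T, Integrable (Q T) P) (hQM : ∀ T ω, Q T ω ≤ M)
    (hQJ : ∀ T, 1 ≤ T → ∀ ω, Q T ω ≤ J T ω) (hc : ∀ T, 1 ≤ T → c T ≤ ∫ ω, Q T ω ∂P)
    (hcb : Tendsto c atTop (𝓝 b)) :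
    ENNReal.ofReal b ≤ liminf (fun T : ℕ => ∫⁻ ω, ENNReal.ofReal (J T ω) ∂P) atTop ∧
      ∀ Jlim : Ω → ℝ≥0∞,
        (∀ᵐ ω ∂P, Tendsto (fun T : ℕ => ENNReal.ofReal (J T ω)) atTop (𝓝 (Jlim ω))) →
        ENNReal.ofReal b ≤ ∫⁻ ω, Jlim ω ∂P := by
  have hlim : Tendsto (fun T => ENNReal.ofReal (c T)) atTop (𝓝 (ENNReal.ofReal b)) :=
    ENNReal.tendsto_ofReal hcb
  have hcQ : ∀ T, 1 ≤ T → ENNReal.ofReal (c T) ≤ ∫⁻ ω, ENNReal.ofReal (Q T ω) ∂P := fun T hT =>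
    (ENNReal.ofReal_le_ofReal (hc T hT)).trans (ofReal_integral_le_lintegral_ofReal (hQi T))
  constructor
  · rw [← hlim.liminf_eq]
    refine liminf_le_liminf ?_
    filter_upwards [eventually_ge_atTop 1] with T hT
    exact (hcQ T hT).trans (lintegral_mono fun ω => ENNReal.ofReal_le_ofReal (hQJ T hT ω))
  · intro Jlim hJlim
    rw [← hlim.limsup_eq]
    -- Reverse Fatou, applied to `Q`, which is measurable and bounded above by `M`; the sequence `J`
    -- enters only through monotonicity of the lower integral.
    calc _ ≤ limsup (fun T : ℕ => ∫⁻ ω, ENNReal.ofReal (Q T ω) ∂P) atTop := by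
          refine limsup_le_limsup ?_
          filter_upwards [eventually_ge_atTop 1] with T hT using hcQ T hT
      _ ≤ ∫⁻ ω, limsup (fun T : ℕ => ENNReal.ofReal (Q T ω)) atTop ∂P :=
          limsup_lintegral_le (fun _ => ENNReal.ofReal M) (fun T => (hQm T).ennreal_ofReal)
            (fun T => ae_of_all _ fun ω => ENNReal.ofReal_le_ofReal (hQM T ω)) (by simp)
      _ ≤ _ := by
          refine lintegral_mono_ae ?_
          filter_upwards [hJlim] with ω hω
          rw [← hω.limsup_eq]
          refine limsup_le_limsup ?_
          filter_upwards [eventually_ge_atTop 1] with T hT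
          exact ENNReal.ofReal_le_ofReal (hQJ T hT ω)

end Limits

/-! ### The lower bound on the weighted age -/

theorem theorem1 {Ω A Θ : Type*} [MeasurableSpace Ω] [Fintype A] [Nontrivial A]
    [MeasurableSpace A] [MeasurableSingletonClass A] [MeasurableSpace Θ]
    (P : Measure Ω) [IsProbabilityMeasure P]
    (ε : Fin 2 → ℝ) (ε₁₂ : ℝ) (hε : ∀ i, ε i < 1)
    (α : Fin 2 → ℝ) (hα : ∀ i, 0 ≤ α i) (hα_sum : α 0 + α 1 = 1)
    (W : Fin 2 → ℤ → Ω → A) (Z : ℕ → Fin 2 → Ω → Bool) (θ : Ω → Θ)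
    (hmodel : IsErasureModel P ε ε₁₂ W Z θ)
    (S : InitialState A) (π : Policy A Θ S)
    (J : ℕ → Ω → ℝ)
    (hJ : ∀ T ω, J T ω =
      π.weightedAge α T (θ ω) (fun i t => W i t ω) (fun k i => Z k i ω)) :
    ENNReal.ofReal (ageLowerBound α ε ε₁₂) ≤
        liminf (fun T : ℕ => ∫⁻ ω, ENNReal.ofReal (J T ω) ∂P) atTop ∧
      ∀ Jlim : Ω → ℝ≥0∞,
        (∀ᵐ ω ∂P, Tendsto (fun T : ℕ => ENNReal.ofReal (J T ω)) atTop (𝓝 (Jlim ω))) →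
        ENNReal.ofReal (ageLowerBound α ε ε₁₂) ≤ ∫⁻ ω, Jlim ω ∂P := by
  set c : Fin 2 → ℝ := fun i => 2 - ε₁₂ - ε (otherUser i) with hc_def
  set C : ℝ := (1 - ε₁₂) * (2 - ε 0 - ε 1) with hC_def
  have hε₁₂ : ε₁₂ < 1 := hmodel.erasure_both_le.trans_lt (hε 0)
  have hc : ∀ i, 0 ≤ c i := fun i => by
    have := hε (otherUser i)
    simp only [hc_def]
    linarith
  have hC : 0 < C := mul_pos (by linarith) (by linarith [hε 0, hε 1])
  set s : ℝ := ∑ i, √(α i * c i) with hs_def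
  set r : ℝ := s / C with hr_def
  have hr : 0 ≤ r := div_nonneg (Finset.sum_nonneg fun i _ => Real.sqrt_nonneg _) hC.le
  set m : Fin 2 → ℕ → Ω → ℝ := IsErasureModel.decodedCount π W Z θ with hm_def
  have hm : ∀ i T ω, 0 ≤ m i T ω := fun i T ω => Nat.cast_nonneg _
  have hmi : ∀ i T, Integrable (m i T) P := fun i T => hmodel.integrable_decodedCount π i T
  set Q : ℕ → Ω → ℝ := fun T ω =>
    r * s / 2 + 1 / 4 - r ^ 2 / (4 * T) * ∑ i, c i * (1 + m i T ω) with hQ_def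
  have hterm_int : ∀ T i, Integrable (fun ω => c i * (1 + m i T ω)) P := fun T i =>
    ((integrable_const _).add (hmi i T)).const_mul _
  have hsum_int : ∀ T, Integrable (fun ω => ∑ i, c i * (1 + m i T ω)) P := fun T =>
    integrable_finsetSum _ fun i _ => hterm_int T i
  have hQJ : ∀ T, 1 ≤ T → ∀ ω, Q T ω ≤ J T ω := by
    intro T hT ω
    have hT0 : (0 : ℝ) < T := by exact_mod_cast hT
    -- For `α i > 0` this is r √(c_i / α_i), the spacing T / m_i for the m_i minimizing Σ α_i / m_i
    -- under Σ c_i m_i = T C. It makes `α i * l i ^ 2` equal to `r ^ 2 * c i`, so the counts enter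
    -- with the weights of the outer bound. If `α i = 0`, the quotient is 0 and `hl2` is only an
    -- inequality.
    set l : Fin 2 → ℝ := fun i => r * √(α i * c i) / α i with hl_def
    have hl1 : ∀ i, α i * l i = r * √(α i * c i) := by
      intro i
      rcases eq_or_ne (α i) 0 with h0 | h0
      · simp [h0]
      · simp only [hl_def]
        field_simp
    have hl2 : ∀ i, α i * l i ^ 2 ≤ r ^ 2 * c i := by
      intro i
      rcases eq_or_ne (α i) 0 with h0 | h0
      · simpa [h0] using mul_nonneg (sq_nonneg r) (hc i)
      · refine le_of_eq ?_
        simp only [hl_def]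
        rw [div_pow, mul_pow, Real.sq_sqrt (mul_nonneg (hα i) (hc i))]
        field_simp
    have hage : ∀ i, α i * l i * T + α i / 2 * T - r ^ 2 * c i / 2 * (1 + m i T ω) ≤
        α i * ∑ k ∈ Finset.Icc 1 T,
          (π.age i k (θ ω) (fun i t => W i t ω) (fun k i => Z k i ω) : ℝ) := by
      intro i
      have h1 := mul_le_mul_of_nonneg_left (π.sum_age_ge i T (θ ω) (fun i t => W i t ω)
        (fun k i => Z k i ω) (l i)) (hα i)
      have h2 := mul_le_mul_of_nonneg_right (hl2 i) (by linarith [hm i T ω] : 0 ≤ 1 + m i T ω)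
      change α i * ((l i + 1 / 2) * T - l i ^ 2 / 2 * (1 + m i T ω)) ≤ _ at h1
      linarith
    have hsum : r * s * T + T / 2 - r ^ 2 / 2 * ∑ i, c i * (1 + m i T ω) ≤
        ∑ k ∈ Finset.Icc 1 T, ∑ i, α i *
          (π.age i k (θ ω) (fun i t => W i t ω) (fun k i => Z k i ω) : ℝ) := by
      rw [Finset.sum_comm]
      simp only [← Finset.mul_sum]
      refine le_trans (le_of_eq ?_) (Finset.sum_le_sum fun i _ => hage i)
      simp only [hl1, hs_def, Fin.sum_univ_two]
      have : α 1 = 1 - α 0 := by linarith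
      rw [this]
      ring
    rw [hJ, Policy.weightedAge]
    refine le_trans (le_of_eq ?_) (mul_le_mul_of_nonneg_left hsum (by positivity))
    simp only [hQ_def]
    field_simp
    ring
  -- The choice `r = s / C` maximizes `r * s / 2 - r ^ 2 / 4 * C`.
  have hB : ageLowerBound α ε ε₁₂ = r * s / 2 + 1 / 4 - r ^ 2 / 4 * C := by
    have : ageLowerBound α ε ε₁₂ = 1 / 4 * (s ^ 2 / C + 1) := rfl
    rw [this, hr_def]
    field_simp
    ring
  refine le_liminf_lintegral_and_le_lintegral_lim (Q := Q) (M := r * s / 2 + 1 / 4)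
    -- The error of order 1/T comes from the summand 1 in `1 + m i T ω`.
    (c := fun T => ageLowerBound α ε ε₁₂ - r ^ 2 / 4 * (∑ i, c i) / T) ?_ ?_ ?_ hQJ ?_ ?_
  · intro T
    exact (Finset.measurable_sum _ fun i _ =>
      ((hmodel.measurable_decodedCount π i T).const_add _).const_mul _).const_mul _ |>.const_sub _
  · exact fun T => (integrable_const _).sub ((hsum_int T).const_mul _)
  · intro T ω
    refine sub_le_self _ (mul_nonneg (by positivity) (Finset.sum_nonneg fun i _ => ?_))
    exact mul_nonneg (hc i) (by linarith [hm i T ω])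
  · intro T hT
    have hT0 : (0 : ℝ) < T := by exact_mod_cast hT
    have h1 : ∫ ω, Q T ω ∂P = r * s / 2 + 1 / 4 -
        r ^ 2 / (4 * T) * (∑ i, c i + ∑ i, c i * ∫ ω, m i T ω ∂P) := by
      simp only [hQ_def]
      rw [integral_sub (integrable_const _) ((hsum_int T).const_mul _), integral_const_mul,
        integral_finsetSum _ fun i _ => hterm_int T i,
        ← Finset.sum_add_distrib]
      simp only [integral_const, probReal_univ, one_smul]
      congr 2
      refine Finset.sum_congr rfl fun i _ => ?_
      rw [integral_const_mul, integral_add (integrable_const _) (hmi i T)]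
      simp only [integral_const, probReal_univ, one_smul]
      ring
    have h2 : ∑ i, c i * ∫ ω, m i T ω ∂P ≤ T * C :=
      hmodel.sum_integral_decodedCount_le hε π T
    have h3 : r ^ 2 / (4 * T) * (∑ i, c i * ∫ ω, m i T ω ∂P) ≤ r ^ 2 / 4 * C := by
      calc _ ≤ r ^ 2 / (4 * T) * (T * C) := by gcongr
        _ = _ := by field_simp
    have h4 : r ^ 2 / 4 * (∑ i, c i) / T = r ^ 2 / (4 * T) * ∑ i, c i := by field_simp
    rw [h1, hB, h4, mul_add]
    linarith
  · have h := (tendsto_const_div_atTop_nhds_zero_nat (r ^ 2 / 4 * ∑ i, c i)).const_sub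
      (ageLowerBound α ε ε₁₂)
    simpa using h
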